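/- **Setting.** Let $\mathcal X$ be a metric space with its Borel $\sigma$-algebra and $\rho$ a probability measure on $\mathcal X\times\mathbb R$ (responses may lie in a subset $\mathcal Y\subset\mathbb R$), the law of $(X,Y)$, whose marginal $\rho_X$ on $\mathcal X$ is concentrated on a separable set (automatic if $\mathcal X$ is separable). Assume the regression model $Y=f^*(X)+\epsilon$, where $f^*:\mathcal X\to\mathbb R$ is measurable and, for every $x\in\mathcal X$, the noise $\epsilon$ given $X=x$ has a probability density $p_{\epsilon|X=x}(t)$, jointly measurable in $(x,t)$, with conditional mean $0$ whenever that mean exists. For measurable $f:\mathcal X\to\mathbb R$ let $p_E$ be the density of $E=Y-f(X)$, let $\mathscr R(f)=-\log\int_{\mathbb R}p_E(e)^2\,de$, and for $h>0$ let $G_h(t)=\frac1{\sqrt{2\pi}h}e^{-t^2/(2h^2)}$ and $$\mathcal E_h(f)=-\iint G_h\big((y-f(x))-(y'-f(x'))\big)\,d\rho(x,y)\,d\rho(x',y').$$ *Admissible model.* The densities $p_{\epsilon|X=x}$ are bounded by a constant independent of $x$, $f^*$ is bounded, and $\mathscr R$ attains its minimum over all measurable functions. *Admissible hypothesis space.*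 $\mathcal H$ is a uniformly bounded set of continuous functions on $\mathcal X$ that contains $f^*$ and a minimizer of $\mathscr R$, and there are $c>0$ and $0<s<2$ with $\log\mathcal N_2(\mathcal H,\varepsilon)\le c\,\varepsilon^{-s}$ for all $\varepsilon>0$. Here $\mathcal N_2(\mathcal H,\varepsilon)=\sup_n\sup_{\mathbf x\in\mathcal X^n}\mathcal N(\mathcal H|_{\mathbf x},\varepsilon,d_2)$, where $\mathcal N(S,\varepsilon,d_2)$ is the minimal number of $d_2$-balls in $\mathbb R^n$ of radius $\varepsilon$ covering $S$, $\mathcal H|_{\mathbf x}=\{(f(x_i))_{i=1}^n: f\in\mathcal H\}$ and $d_2(\mathbf a,\mathbf b)=\big(\frac1n\sum_{i=1}^n|a_i-b_i|^2\big)^{1/2}$. *The class $\mathcal P_1$.* $\rho\in\mathcal P_1$ means: for every $x$, $p_{\epsilon|X=x}$ is even and unimodal (increasing on $(-\infty,t_0]$ and decreasing on $[t_0,\infty)$ for some $t_0$); its Fourier transform $\widehat{p_{\epsilon|X=x}}(\xi)=\int p_{\epsilon|X=x}(t)e^{-it\xi}\,dt$ is nonnegative on $\mathbb R$ for every $x$;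 and there are $c_0,C_0>0$ with $\widehat{p_{\epsilon|X=x}}(\xi)\ge C_0$ for all $|\xi|\le c_0$ and all $x$. *The algorithm.* For an i.i.d. sample $\mathbf z=\{(x_i,y_i)\}_{i=1}^n$ from $\rho$, $f_{\mathbf z}$ is a minimizer over $f\in\mathcal H$ of $$\mathscr R_{\mathbf z}(f)=-\log\Big(\frac1{n^2}\sum_{i,j=1}^nG_h(e_i-e_j)\Big),\qquad e_i=y_i-f(x_i)$$ (assumed to exist for almost every sample; when several exist, any choice is allowed). **Theorem.** Let the model and $\mathcal H$ be admissible and $\rho\in\mathcal P_1$. 1. For every $h>0$ and every constant $b\in\mathbb R$, $f^*+b$ minimizes $\mathcal E_h$ among all measurable functions $f:\mathcal X\to\mathbb R$. 2. For every fixed $h>0$, $f_{\mathbf z}+\mathbf E_x(f^*-f_{\mathbf z})$ converges to $f^*$ in probability: for every $\varepsilon>0$, $$\lim_{n\to\infty}\mathbf P\Big(\|f_{\mathbf z}+\mathbf E_x(f^*-f_{\mathbf z})-f^*\|_{L^2_{\rho_X}}^2>\varepsilon\Big)=0,$$ where $\mathbf E_x g=\int g\,d\rho_X$. 3. For every fixed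 $h>0$ there is a constant $C>0$, depending only on $\rho$, $\mathcal H$ and $h$, such that for all $n\ge1$ and $0<\delta<1$, with probability at least $1-\delta$, $$\|f_{\mathbf z}+\mathbf E_x(f^*-f_{\mathbf z})-f^*\|_{L^2_{\rho_X}}^2\le C\sqrt{\log(2/\delta)}\;n^{-1/2}.$$ If $\mathbf z\mapsto f_{\mathbf z}$ is not measurable, probabilities of the failure events in 2 and 3 are outer probabilities. -/

import Mathlib

open MeasureTheory Filter Topology Set
open scoped ENNReal NNReal

noncomputable section

namespace MEE

/-- The Gaussian kernel `G_h(t) = exp(-t² / (2 h²)) / (√(2π) h)`. -/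
def gaussKernel (h t : ℝ) : ℝ :=
  1 / (Real.sqrt (2 * Real.pi) * h) * Real.exp (-t ^ 2 / (2 * h ^ 2))

/-- The Fourier transform with the normalisation `∫ f(t) e^{-i t ξ} dt`. -/
def fourierHat (f : ℝ → ℝ) (ξ : ℝ) : ℂ :=
  ∫ t, (f t : ℂ) * Complex.exp (-(Complex.I * t * ξ))

/-- Increasing on `(-∞, m]` and decreasing on `[m, ∞)` for some `m`. -/
def Unimodal (f : ℝ → ℝ) : Prop :=
  ∃ m : ℝ, MonotoneOn f (Iic m) ∧ AntitoneOn f (Ici m)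

section Model

variable {X : Type*} [MeasurableSpace X]

/-- The law of the error variable `E = Y - f(X)` when `(X, Y)` has law `ρ`. -/
def errorLaw (ρ : Measure (X × ℝ)) (f : X → ℝ) : Measure ℝ :=
  ρ.map (fun z => z.2 - f z.1)

/-- The probability density function `p_E` of the error variable `E = Y - f(X)`. -/
def errorDensity (ρ : Measure (X × ℝ)) (f : X → ℝ) (e : ℝ) : ℝ :=
  ((errorLaw ρ f).rnDeriv volume e).toReal

/-- Rényi's error entropy of order two, `-log ∫ p_E(e)² de`. -/
def renyiEntropy (ρ : Measure (X × ℝ)) (f : X → ℝ) : ℝ :=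
  -Real.log (∫ e, errorDensity ρ f e ^ 2)

/-- `f` minimizes Rényi's error entropy among all measurable functions. -/
def IsEntropyMinimizer (ρ : Measure (X × ℝ)) (f : X → ℝ) : Prop :=
  Measurable f ∧ ∀ g : X → ℝ, Measurable g → renyiEntropy ρ f ≤ renyiEntropy ρ g

/-- The information error
`-∫∫ G_h((y - f(x)) - (y' - f(x'))) dρ(x, y) dρ(x', y')`. -/
def informationError (ρ : Measure (X × ℝ)) (h : ℝ) (f : X → ℝ) : ℝ :=
  -∫ z, ∫ z', gaussKernel h ((z.2 - f z.1) - (z'.2 - f z'.1)) ∂ρ ∂ρ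

/-- `f` minimizes the information error among all measurable functions. -/
def IsInformationErrorMinimizer (ρ : Measure (X × ℝ)) (h : ℝ) (f : X → ℝ) : Prop :=
  Measurable f ∧ ∀ g : X → ℝ, Measurable g → informationError ρ h f ≤ informationError ρ h g

/-- The regression model `Y = f*(X) + ε`, `E(ε | X) = 0`, for `(X, Y)` of law `ρ`, in which `p x`
is the density of the noise `ε` given `X = x`, i.e. `(X, ε)` has density `p` with respect to
`ρ_X ⊗ dt`.  Heavy tailed noise is allowed: the conditional mean vanishes whenever it exists. -/
structure IsRegressionModel (ρ : Measure (X × ℝ)) (fstar : X → ℝ) (p : X → ℝ → ℝ) : Prop where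
  measurable_fstar : Measurable fstar
  measurable_density : Measurable (Function.uncurry p)
  density_nonneg : ∀ x t, 0 ≤ p x t
  lintegral_density : ∀ x, ∫⁻ t, ENNReal.ofReal (p x t) = 1
  law_noise : ρ.map (fun z => (z.1, z.2 - fstar z.1)) =
    (ρ.fst.prod volume).withDensity (fun q => ENNReal.ofReal (p q.1 q.2))
  mean_zero : ∀ x, Integrable (fun t => t * p x t) → ∫ t, t * p x t = 0

/-- MEE admissibility of the regression model. -/
structure IsAdmissibleModel (ρ : Measure (X × ℝ)) (fstar : X → ℝ) (p : X → ℝ → ℝ) : Prop where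
  density_bounded : ∃ Mp : ℝ, ∀ x t, p x t ≤ Mp
  fstar_bounded : ∃ M : ℝ, 0 < M ∧ ∀ x, |fstar x| ≤ M
  exists_entropyMinimizer : ∃ f : X → ℝ, IsEntropyMinimizer ρ f

/-- The noise class `P₁`, as a condition on the conditional noise densities `p x`. -/
structure IsNoiseClassP1 (p : X → ℝ → ℝ) : Prop where
  symmetric : ∀ x t, p x (-t) = p x t
  unimodal : ∀ x, Unimodal (p x)
  fourier_nonneg : ∀ x ξ, (fourierHat (p x) ξ).im = 0 ∧ 0 ≤ (fourierHat (p x) ξ).re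
  fourier_lower : ∃ c₀ C₀ : ℝ, 0 < c₀ ∧ 0 < C₀ ∧
    ∀ x, ∀ ξ ∈ Icc (-c₀) c₀, C₀ ≤ (fourierHat (p x) ξ).re

/-- The constant adjustment `E_x(f* - f)`. -/
def adjustment (ρ : Measure (X × ℝ)) (fstar f : X → ℝ) : ℝ :=
  ∫ x, (fstar x - f x) ∂ρ.fst

/-- The squared distance `‖f + E_x(f* - f) - f*‖²` in `L²(ρ_X)`. -/
def adjustedSqError (ρ : Measure (X × ℝ)) (fstar f : X → ℝ) : ℝ :=
  ∫ x, (f x + adjustment ρ fstar f - fstar x) ^ 2 ∂ρ.fst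

end Model

section Hypothesis

variable {X : Type*}

/-- The `ℓ₂`-norm empirical covering number
`N₂(H, ε) = sup_n sup_{x ∈ Xⁿ} N(H|_x, ε, d₂)`, where
`d₂(a, b) = (n⁻¹ ∑ |a_i - b_i|²)^{1/2}`.  A `d₂`-ball of radius `ε` in `ℝⁿ` is a Euclidean ball
of radius `ε √n`. -/
def empiricalCoveringNumber (H : Set (X → ℝ)) (ε : ℝ≥0) : ℕ∞ :=
  ⨆ (n : ℕ) (x : Fin n → X),
    Metric.externalCoveringNumber (ε * NNReal.sqrt (n : ℝ≥0))
      ((fun f : X → ℝ => (WithLp.toLp 2 (fun i => f (x i)) : EuclideanSpace ℝ (Fin n))) '' H)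

/-- The empirical Rényi entropy of the sample `z`,
`-log (n⁻² ∑_{i,j} G_h(e_i - e_j))` with `e_i = y_i - f(x_i)`. -/
def empiricalEntropy {n : ℕ} (h : ℝ) (z : Fin n → X × ℝ) (f : X → ℝ) : ℝ :=
  -Real.log (1 / (n : ℝ) ^ 2 * ∑ i, ∑ j,
    gaussKernel h (((z i).2 - f (z i).1) - ((z j).2 - f (z j).1)))

/-- `f` is an output of the MEE algorithm on the sample `z`: a minimizer of the empirical entropy
over the hypothesis space `H`. -/
def IsEmpiricalMinimizer {n : ℕ} (H : Set (X → ℝ)) (h : ℝ) (z : Fin n → X × ℝ)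
    (f : X → ℝ) : Prop :=
  f ∈ H ∧ ∀ g ∈ H, empiricalEntropy h z f ≤ empiricalEntropy h z g

/-- `fz` is a version of the MEE algorithm with bandwidth `h`: it assigns to (almost) every sample
of size `n ≥ 1` a minimizer of the empirical entropy over `H`. -/
def IsMEEAlgorithm [MeasurableSpace X] (ρ : Measure (X × ℝ)) (H : Set (X → ℝ)) (h : ℝ)
    (fz : (n : ℕ) → (Fin n → X × ℝ) → X → ℝ) : Prop :=
  ∀ n : ℕ, 1 ≤ n →
    ∀ᵐ z ∂(Measure.pi fun _ : Fin n => ρ), IsEmpiricalMinimizer H h z (fz n z)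

/-- MEE admissibility of a hypothesis space `H` of continuous functions. -/
structure IsAdmissibleSpace [TopologicalSpace X] [MeasurableSpace X] (ρ : Measure (X × ℝ))
    (fstar : X → ℝ) (H : Set (X → ℝ)) : Prop where
  continuous : ∀ f ∈ H, Continuous f
  bounded : ∃ M : ℝ, ∀ f ∈ H, ∀ x, |f x| ≤ M
  covering : ∃ c s : ℝ, 0 < c ∧ 0 < s ∧ s < 2 ∧ ∀ ε : ℝ≥0, 0 < ε →
    ENNReal.log (empiricalCoveringNumber H ε : ℝ≥0∞) ≤ ((c * (ε : ℝ) ^ (-s) : ℝ) : EReal)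
  entropyMinimizer_mem : ∃ f ∈ H, IsEntropyMinimizer ρ f
  fstar_mem : fstar ∈ H

end Hypothesis

end MEE

end

/-!
By Fourier inversion the negative of the information error of `f` is `G_h(0) ∫ |φ_f(ξ)|² dγ(ξ)`,
where `φ_f` is the characteristic function of `Y - f(X)` and `γ` is the centred Gaussian law of
variance `h⁻²`. Under the model, `φ_f(ξ) = ∫ φ_{ε|x}(ξ) exp(iξ(f* - f)(x)) dρ_X(x)` with
`φ_{ε|x} ≥ 0`, so `|φ_f|` is largest when the phase is independent of `x`, as for `f* + b`. At
frequencies small enough that `φ_{ε|x}` stays away from `0` and the phase differences stay in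
`[-π, π]`, the loss in `|φ_f|²` is at least a multiple of `ξ² Var (f* - f)(X)`. Hence the excess
information error dominates the squared distance to `f*` modulo constants.

The empirical information error is the same functional of the empirical law of the residuals. At a
fixed frequency the features `exp(iξ(y - f(x)))` are bounded and Lipschitz in `f`, so
symmetrization and chaining give sub-Gaussian tails for the uniform deviation of the empirical
characteristic function, with a scale growing at most like `exp |ξ|`; by convexity these tails
survive averaging over `γ`. For the possibly nonmeasurable supremum over `H`, the deviation events
are open, so by the Lindelöf property of the support it is enough to bound finite subfamilies.
-/

noncomputable section

namespace MEE

open ProbabilityTheory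

section SubgaussianTails

variable {Ω : Type*} {mΩ : MeasurableSpace Ω} {μ : Measure Ω} {Y Z : Ω → ℝ} {σ τ : ℝ}

lemma integrable_exp_mul_of_le {l : ℝ} {g : Ω → ℝ} (hY : AEMeasurable Y μ) (hg : Integrable g μ)
    (hle : ∀ ω, Real.exp (l * Y ω) ≤ g ω) : Integrable (fun ω => Real.exp (l * Y ω)) μ :=
  hg.mono' (hY.const_mul l).exp.aestronglyMeasurable
    (ae_of_all _ fun ω => by simpa only [Real.norm_eq_abs, Real.abs_exp] using hle ω)

/-- Sub-Gaussian upper tails of scale `τ`: `E exp (l Y) ≤ 2 exp (l² τ²)` for all `l ≥ 0`.  The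
factor `2` admits variables that are not centred, such as norms and maxima, and `τ` is a scale
rather than a variance so that it is additive for sums of dependent variables. -/
structure HasUpperSubgaussianMGF (Y : Ω → ℝ) (τ : ℝ) (μ : Measure Ω) : Prop where
  integrable_exp_mul : ∀ l, 0 ≤ l → Integrable (fun ω => Real.exp (l * Y ω)) μ
  mgf_le : ∀ l, 0 ≤ l → mgf Y μ l ≤ 2 * Real.exp ((l * τ) ^ 2)

namespace HasUpperSubgaussianMGF

lemma aemeasurable (hY : HasUpperSubgaussianMGF Y τ μ) : AEMeasurable Y μ :=
  Real.aemeasurable_of_aemeasurable_exp_mul one_ne_zero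
    (hY.integrable_exp_mul 1 zero_le_one).aemeasurable

lemma mono_scale (hY : HasUpperSubgaussianMGF Y σ μ) (hσ : 0 ≤ σ) (hστ : σ ≤ τ) :
    HasUpperSubgaussianMGF Y τ μ where
  integrable_exp_mul := hY.integrable_exp_mul
  mgf_le l hl := (hY.mgf_le l hl).trans (by gcongr)

lemma of_tendsto {α : Type*} {l : Filter α} [l.NeBot] {σ : α → ℝ} (hσ : Tendsto σ l (𝓝 τ))
    (hY : ∀ᶠ a in l, HasUpperSubgaussianMGF Y (σ a) μ) : HasUpperSubgaussianMGF Y τ μ where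
  integrable_exp_mul := hY.exists.choose_spec.integrable_exp_mul
  mgf_le t ht :=
    ge_of_tendsto (((Real.continuous_exp.tendsto _).comp ((hσ.const_mul t).pow 2)).const_mul 2)
      (hY.mono fun _ h => h.mgf_le t ht)

lemma mono (hZ : HasUpperSubgaussianMGF Z τ μ) (hY : AEMeasurable Y μ) (hYZ : ∀ ω, Y ω ≤ Z ω) :
    HasUpperSubgaussianMGF Y τ μ := by
  have hle (l : ℝ) (hl : 0 ≤ l) (ω : Ω) : Real.exp (l * Y ω) ≤ Real.exp (l * Z ω) :=
    Real.exp_le_exp.2 (mul_le_mul_of_nonneg_left (hYZ ω) hl)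
  have hint (l : ℝ) (hl : 0 ≤ l) : Integrable (fun ω => Real.exp (l * Y ω)) μ :=
    integrable_exp_mul_of_le hY (hZ.integrable_exp_mul l hl) (hle l hl)
  exact ⟨hint, fun l hl => (integral_mono (hint l hl) (hZ.integrable_exp_mul l hl)
    (hle l hl)).trans (hZ.mgf_le l hl)⟩

lemma zero [IsProbabilityMeasure μ] : HasUpperSubgaussianMGF (fun _ => 0) 0 μ where
  integrable_exp_mul l _ := by simp
  mgf_le l _ := by simp [mgf]

lemma add_of_pos (hY : HasUpperSubgaussianMGF Y σ μ) (hZ : HasUpperSubgaussianMGF Z τ μ)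
    (hσ : 0 < σ) (hτ : 0 < τ) : HasUpperSubgaussianMGF (fun ω => Y ω + Z ω) (σ + τ) μ := by
  set a := σ / (σ + τ) with ha
  set b := τ / (σ + τ) with hb
  have ha0 : 0 < a := by positivity
  have hb0 : 0 < b := by positivity
  have hab : a + b = 1 := by rw [ha, hb]; field_simp
  have hconvex (l : ℝ) (ω : Ω) : Real.exp (l * (Y ω + Z ω)) ≤
      a * Real.exp (l / a * Y ω) + b * Real.exp (l / b * Z ω) := by
    have h := convexOn_exp.2 (mem_univ (l / a * Y ω)) (mem_univ (l / b * Z ω)) ha0.le hb0.le hab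
    simp only [smul_eq_mul] at h
    rwa [show a * (l / a * Y ω) + b * (l / b * Z ω) = l * (Y ω + Z ω) by field_simp] at h
  have hbound (l : ℝ) (hl : 0 ≤ l) :
      Integrable (fun ω => a * Real.exp (l / a * Y ω) + b * Real.exp (l / b * Z ω)) μ :=
    ((hY.integrable_exp_mul _ (by positivity)).const_mul a).add
      ((hZ.integrable_exp_mul _ (by positivity)).const_mul b)
  have hint (l : ℝ) (hl : 0 ≤ l) : Integrable (fun ω => Real.exp (l * (Y ω + Z ω))) μ :=
    integrable_exp_mul_of_le (hY.aemeasurable.add hZ.aemeasurable) (hbound l hl) (hconvex l)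
  refine ⟨hint, fun l hl => ?_⟩
  calc mgf (fun ω => Y ω + Z ω) μ l
      ≤ ∫ ω, (a * Real.exp (l / a * Y ω) + b * Real.exp (l / b * Z ω)) ∂μ :=
        integral_mono (hint l hl) (hbound l hl) (hconvex l)
    _ = a * mgf Y μ (l / a) + b * mgf Z μ (l / b) := by
        rw [integral_add ((hY.integrable_exp_mul _ (by positivity)).const_mul a)
          ((hZ.integrable_exp_mul _ (by positivity)).const_mul b), integral_const_mul,
          integral_const_mul]
        rfl
    _ ≤ a * (2 * Real.exp ((l / a * σ) ^ 2)) + b * (2 * Real.exp ((l / b * τ) ^ 2)) := by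
        gcongr
        exacts [hY.mgf_le _ (by positivity), hZ.mgf_le _ (by positivity)]
    _ = 2 * Real.exp ((l * (σ + τ)) ^ 2) := by
        have h₁ : l / a * σ = l * (σ + τ) := by rw [ha]; field_simp
        have h₂ : l / b * τ = l * (σ + τ) := by rw [hb]; field_simp
        rw [h₁, h₂, ← add_mul, hab, one_mul]

lemma add (hY : HasUpperSubgaussianMGF Y σ μ) (hZ : HasUpperSubgaussianMGF Z τ μ)
    (hσ : 0 ≤ σ) (hτ : 0 ≤ τ) : HasUpperSubgaussianMGF (fun ω => Y ω + Z ω) (σ + τ) μ := by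
  have hlim : Tendsto (fun η => σ + η + (τ + η)) (𝓝[>] 0) (𝓝 (σ + τ)) := by
    have h : Continuous fun η : ℝ => σ + η + (τ + η) := by fun_prop
    simpa using (h.tendsto 0).mono_left nhdsWithin_le_nhds
  refine of_tendsto hlim (eventually_nhdsWithin_of_forall fun η (hη : 0 < η) => ?_)
  exact (hY.mono_scale hσ (by linarith)).add_of_pos (hZ.mono_scale hτ (by linarith))
    (by linarith) (by linarith)

lemma sum [IsProbabilityMeasure μ] {κ : Type*} {s : Finset κ} {Y : κ → Ω → ℝ} {τ : κ → ℝ}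
    (hY : ∀ k ∈ s, HasUpperSubgaussianMGF (Y k) (τ k) μ) (hτ : ∀ k ∈ s, 0 ≤ τ k) :
    HasUpperSubgaussianMGF (fun ω => ∑ k ∈ s, Y k ω) (∑ k ∈ s, τ k) μ := by
  classical
  induction s using Finset.induction_on with
  | empty => simpa only [Finset.sum_empty] using zero
  | insert k s hk ih =>
    simp only [Finset.forall_mem_insert] at hY hτ
    simp only [Finset.sum_insert hk]
    exact hY.1.add (ih hY.2 hτ.2) hτ.1 (Finset.sum_nonneg hτ.2)

lemma const_mul {a : ℝ} (hY : HasUpperSubgaussianMGF Y τ μ) (ha : 0 ≤ a) :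
    HasUpperSubgaussianMGF (fun ω => a * Y ω) (a * τ) μ where
  integrable_exp_mul l hl := by
    simpa only [mul_assoc] using hY.integrable_exp_mul (l * a) (by positivity)
  mgf_le l hl := by
    have h := hY.mgf_le (l * a) (by positivity)
    simpa only [mgf, mul_assoc] using h

/-- Jensen's inequality for the power `q = log₂ (2 N)`, chosen so that `(2 N) ^ (1 / q) = 2`. -/
lemma of_mgf_le_mul [IsProbabilityMeasure μ] {N : ℝ} (hN : 1 ≤ N)
    (hint : ∀ l, 0 ≤ l → Integrable (fun ω => Real.exp (l * Y ω)) μ)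
    (hmgf : ∀ l, 0 ≤ l → mgf Y μ l ≤ N * (2 * Real.exp ((l * τ) ^ 2))) :
    HasUpperSubgaussianMGF Y (√(1 + Real.logb 2 N) * τ) μ := by
  set q := 1 + Real.logb 2 N with hq
  have hq1 : 1 ≤ q := le_add_of_nonneg_right (Real.logb_nonneg one_lt_two hN)
  have h2q : (2 : ℝ) ^ q = 2 * N := by
    rw [hq, Real.rpow_add two_pos, Real.rpow_one, Real.rpow_logb two_pos (by norm_num)
      (by linarith)]
  refine ⟨hint, fun l hl => ?_⟩
  have hrpow (ω : Ω) : Real.exp (l * Y ω) ^ q = Real.exp (l * q * Y ω) := by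
    rw [← Real.exp_mul]; ring_nf
  have hjensen : mgf Y μ l ^ q ≤ mgf Y μ (l * q) := by
    have hconvex := (convexOn_rpow hq1).map_integral_le
      (Real.continuous_rpow_const (by linarith)).continuousOn isClosed_Ici
      (ae_of_all μ fun ω => (Real.exp_pos (l * Y ω)).le) (hint l hl)
    simp only [Function.comp_def, hrpow] at hconvex
    exact hconvex (hint _ (by positivity))
  refine (Real.rpow_le_rpow_iff mgf_nonneg (by positivity) (by linarith : 0 < q)).1 ?_
  calc mgf Y μ l ^ q ≤ N * (2 * Real.exp ((l * q * τ) ^ 2)) :=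
        hjensen.trans (hmgf _ (by positivity))
    _ = (2 * Real.exp ((l * (√q * τ)) ^ 2)) ^ q := by
        rw [Real.mul_rpow two_pos.le (Real.exp_pos _).le, h2q, ← Real.exp_mul, mul_pow, mul_pow,
          mul_pow, mul_pow, Real.sq_sqrt (by linarith)]
        ring_nf

lemma of_exists_le [IsProbabilityMeasure μ] {ι : Type*} [Fintype ι] [Nonempty ι] {Y : ι → Ω → ℝ}
    (hY : ∀ i, HasUpperSubgaussianMGF (Y i) τ μ) (hZ : AEMeasurable Z μ)
    (hZY : ∀ ω, ∃ i, Z ω ≤ Y i ω) :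
    HasUpperSubgaussianMGF Z (√(1 + Real.logb 2 (Fintype.card ι)) * τ) μ := by
  have hle (l : ℝ) (hl : 0 ≤ l) (ω : Ω) :
      Real.exp (l * Z ω) ≤ ∑ i, Real.exp (l * Y i ω) := by
    obtain ⟨i, hi⟩ := hZY ω
    exact (Real.exp_le_exp.2 (mul_le_mul_of_nonneg_left hi hl)).trans
      (Finset.single_le_sum (f := fun i => Real.exp (l * Y i ω)) (fun _ _ => (Real.exp_pos _).le)
        (Finset.mem_univ i))
  have hsum (l : ℝ) (hl : 0 ≤ l) : Integrable (fun ω => ∑ i, Real.exp (l * Y i ω)) μ :=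
    integrable_finsetSum _ fun i _ => (hY i).integrable_exp_mul l hl
  have hint (l : ℝ) (hl : 0 ≤ l) : Integrable (fun ω => Real.exp (l * Z ω)) μ :=
    integrable_exp_mul_of_le hZ (hsum l hl) (hle l hl)
  refine of_mgf_le_mul (mod_cast Fintype.card_pos) hint fun l hl => ?_
  calc mgf Z μ l ≤ ∑ i, mgf (Y i) μ l :=
        (integral_mono (hint l hl) (hsum l hl) (hle l hl)).trans_eq
          (integral_finsetSum _ fun i _ => (hY i).integrable_exp_mul l hl)
    _ ≤ Fintype.card ι * (2 * Real.exp ((l * τ) ^ 2)) :=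
        (Finset.sum_le_card_nsmul _ _ _ fun i _ => (hY i).mgf_le l hl).trans_eq
          (by rw [nsmul_eq_mul, Finset.card_univ])

lemma integral_param [IsProbabilityMeasure μ] {Θ : Type*} {mΘ : MeasurableSpace Θ}
    {ν : Measure Θ} [IsProbabilityMeasure ν] {Y : Θ → Ω → ℝ} {B : ℝ}
    (hmeas : Measurable (Function.uncurry Y)) (hbound : ∀ θ ω, |Y θ ω| ≤ B)
    (hY : ∀ θ, HasUpperSubgaussianMGF (Y θ) τ μ) :
    HasUpperSubgaussianMGF (fun ω => ∫ θ, Y θ ω ∂ν) τ μ := by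
  have hint (ω : Ω) : Integrable (fun θ => Y θ ω) ν :=
    .of_bound (hmeas.comp measurable_prodMk_right).aestronglyMeasurable B
      (ae_of_all _ fun θ => hbound θ ω)
  have hexp (l : ℝ) : Measurable fun q : Θ × Ω => Real.exp (l * Y q.1 q.2) :=
    (hmeas.const_mul l).exp
  have hexp_le (l : ℝ) (hl : 0 ≤ l) (θ : Θ) (ω : Ω) :
      ‖Real.exp (l * Y θ ω)‖ ≤ Real.exp (l * B) := by
    rw [Real.norm_eq_abs, Real.abs_exp]
    exact Real.exp_le_exp.2 (mul_le_mul_of_nonneg_left ((le_abs_self _).trans (hbound θ ω)) hl)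
  have hprod (l : ℝ) (hl : 0 ≤ l) :
      Integrable (fun q : Ω × Θ => Real.exp (l * Y q.2 q.1)) (μ.prod ν) :=
    .of_bound ((hexp l).comp measurable_swap).aestronglyMeasurable _
      (ae_of_all _ fun q => hexp_le l hl q.2 q.1)
  have hjensen (l : ℝ) (hl : 0 ≤ l) (ω : Ω) :
      Real.exp (l * ∫ θ, Y θ ω ∂ν) ≤ ∫ θ, Real.exp (l * Y θ ω) ∂ν := by
    rw [← integral_const_mul]
    exact convexOn_exp.map_integral_le Real.continuous_exp.continuousOn isClosed_univ
      (ae_of_all _ fun _ => mem_univ _) ((hint ω).const_mul l)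
      (.of_bound ((hexp l).comp measurable_prodMk_right).aestronglyMeasurable _
        (ae_of_all _ fun θ => hexp_le l hl θ ω))
  have hint' (l : ℝ) (hl : 0 ≤ l) : Integrable (fun ω => Real.exp (l * ∫ θ, Y θ ω ∂ν)) μ :=
    integrable_exp_mul_of_le hmeas.stronglyMeasurable.integral_prod_left.measurable.aemeasurable
      (hprod l hl).integral_prod_left (hjensen l hl)
  refine ⟨hint', fun l hl => ?_⟩
  calc mgf (fun ω => ∫ θ, Y θ ω ∂ν) μ l
      ≤ ∫ ω, ∫ θ, Real.exp (l * Y θ ω) ∂ν ∂μ :=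
        integral_mono (hint' l hl) (hprod l hl).integral_prod_left (hjensen l hl)
    _ = ∫ θ, mgf (Y θ) μ l ∂ν := integral_integral_swap (hprod l hl)
    _ ≤ ∫ _, 2 * Real.exp ((l * τ) ^ 2) ∂ν :=
        integral_mono (hprod l hl).integral_prod_right (integrable_const _)
          fun θ => (hY θ).mgf_le l hl
    _ = 2 * Real.exp ((l * τ) ^ 2) := by simp

lemma measureReal_ge_le [IsFiniteMeasure μ] {u : ℝ} (hY : HasUpperSubgaussianMGF Y τ μ)
    (hu : 0 ≤ u) : μ.real {ω | u ≤ Y ω} ≤ 2 * Real.exp (-u ^ 2 / (4 * τ ^ 2)) := by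
  set l := u / (2 * τ ^ 2) with hl
  have hl0 : 0 ≤ l := by positivity
  calc μ.real {ω | u ≤ Y ω} ≤ Real.exp (-l * u) * mgf Y μ l :=
        measure_ge_le_exp_mul_mgf u hl0 (hY.integrable_exp_mul l hl0)
    _ ≤ Real.exp (-l * u) * (2 * Real.exp ((l * τ) ^ 2)) := by gcongr; exact hY.mgf_le l hl0
    _ = 2 * Real.exp (-u ^ 2 / (4 * τ ^ 2)) := by
        rw [mul_left_comm, ← Real.exp_add]
        congr 2
        rcases eq_or_ne τ 0 with rfl | hτ
        · simp [hl]
        · rw [hl]; field_simp; ring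

end HasUpperSubgaussianMGF

lemma hasUpperSubgaussianMGF_abs {c : ℝ≥0} (hY : HasSubgaussianMGF Y c μ) :
    HasUpperSubgaussianMGF (fun ω => |Y ω|) √(c / 2) μ := by
  have hle (l : ℝ) (ω : Ω) : Real.exp (l * |Y ω|) ≤ Real.exp (l * Y ω) + Real.exp (-l * Y ω) := by
    rcases abs_cases (Y ω) with ⟨h, -⟩ | ⟨h, -⟩ <;> rw [h] <;> [skip; rw [mul_neg, ← neg_mul]]
    exacts [le_add_of_nonneg_right (Real.exp_pos _).le, le_add_of_nonneg_left (Real.exp_pos _).le]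
  have hbound (l : ℝ) : Integrable (fun ω => Real.exp (l * Y ω) + Real.exp (-l * Y ω)) μ :=
    (hY.integrable_exp_mul l).add (hY.integrable_exp_mul (-l))
  have hint (l : ℝ) : Integrable (fun ω => Real.exp (l * |Y ω|)) μ :=
    integrable_exp_mul_of_le hY.aemeasurable.abs (hbound l) (hle l)
  refine ⟨fun l _ => hint l, fun l _ => ?_⟩
  calc mgf (fun ω => |Y ω|) μ l ≤ mgf Y μ l + mgf Y μ (-l) :=
        (integral_mono (hint l) (hbound l) (hle l)).trans_eq
          (integral_add (hY.integrable_exp_mul l) (hY.integrable_exp_mul (-l)))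
    _ ≤ Real.exp (c * l ^ 2 / 2) + Real.exp (c * (-l) ^ 2 / 2) :=
        add_le_add (hY.mgf_le l) (hY.mgf_le (-l))
    _ = 2 * Real.exp ((l * √(c / 2)) ^ 2) := by
        rw [mul_pow, Real.sq_sqrt (by positivity)]
        ring_nf

end SubgaussianTails

section Chaining

lemma log_ncard_range_prodMk_le {ι α β : Type*} [Finite ι] [Nonempty ι] (f : ι → α) (g : ι → β) :
    Real.log (range fun i => (f i, g i)).ncard ≤
      Real.log (range f).ncard + Real.log (range g).ncard := by
  have hf : 0 < (range f).ncard := (ncard_pos (finite_range f)).2 (range_nonempty f)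
  have hg : 0 < (range g).ncard := (ncard_pos (finite_range g)).2 (range_nonempty g)
  have hfg : 0 < (range fun i => (f i, g i)).ncard :=
    (ncard_pos (finite_range _)).2 (range_nonempty _)
  have hsub : (range fun i => (f i, g i)) ⊆ range f ×ˢ range g := by
    rintro _ ⟨i, rfl⟩
    exact ⟨mem_range_self i, mem_range_self i⟩
  rw [← Real.log_mul (mod_cast hf.ne') (mod_cast hg.ne')]
  refine Real.log_le_log (mod_cast hfg) ?_
  exact_mod_cast (ncard_le_ncard hsub ((finite_range f).prod (finite_range g))).trans_eq ncard_prod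

lemma exists_approximating_sequence {ι : Type*} [Finite ι] [Nonempty ι] {E : Type*}
    [PseudoMetricSpace E] {c b D : ℝ} (hc : 0 ≤ c) {u : ι → E} {t₀ : E}
    (hD : ∀ i, dist (u i) t₀ ≤ D)
    (hcover : ∀ k : ℕ, ∃ C : Finset E, (∀ i, ∃ t ∈ C, dist (u i) t ≤ D * (1 / 2) ^ k) ∧
      Real.log C.card ≤ c * b ^ k) :
    ∃ π : ℕ → ι → E, (∀ i, π 0 i = t₀) ∧ (∀ k i, dist (u i) (π k i) ≤ D * (1 / 2) ^ k) ∧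
      ∀ k, Real.log (range (π k)).ncard ≤ c * b ^ k := by
  choose C hC hlogC using hcover
  choose t ht hdist using hC
  refine ⟨fun k => if k = 0 then fun _ => t₀ else t k, by simp, fun k i => ?_, fun k => ?_⟩ <;>
    rcases eq_or_ne k 0 with rfl | hk
  · simpa using hD i
  · simpa only [if_neg hk] using hdist k i
  · simpa using hc
  · have hsub : range (t k) ⊆ C k := range_subset_iff.2 fun i => Finset.mem_coe.2 (ht k i)
    simp only [if_neg hk]
    refine (Real.log_le_log ?_ ?_).trans (hlogC k)
    · exact_mod_cast (ncard_pos (finite_range _)).2 (range_nonempty _)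
    · exact_mod_cast (ncard_le_ncard hsub).trans_eq (ncard_coe_finset _)

variable {Ω : Type*} {mΩ : MeasurableSpace Ω} {μ : Measure Ω} [IsProbabilityMeasure μ]
  {V : Type*} [SeminormedAddCommGroup V] {ι : Type*} [Fintype ι] [Nonempty ι]

lemma pi_norm_eq_ciSup (v : ι → V) : ‖v‖ = ⨆ i, ‖v i‖ :=
  le_antisymm ((pi_norm_le_iff_of_nonempty v).2 (le_ciSup (finite_range _).bddAbove))
    (ciSup_le (norm_le_pi_norm v))

lemma hasUpperSubgaussianMGF_pi_norm {κ : Type*} {G : κ → Ω → V} {g : ι → κ} {τ : ℝ}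
    (hG : ∀ i, HasUpperSubgaussianMGF (fun ω => ‖G (g i) ω‖) τ μ) :
    HasUpperSubgaussianMGF (fun ω => ‖fun i => G (g i) ω‖)
      (√(1 + Real.logb 2 (range g).ncard) * τ) μ := by
  have := Fintype.ofFinite (range g)
  rw [← Nat.card_coe_set_eq, Nat.card_eq_fintype_card]
  refine HasUpperSubgaussianMGF.of_exists_le (Y := fun (k : range g) ω => ‖G k ω‖) ?_ ?_ ?_
  · rintro ⟨_, i, rfl⟩
    exact hG i
  · simp only [pi_norm_eq_ciSup]
    exact AEMeasurable.iSup fun i => (hG i).aemeasurable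
  · intro ω
    obtain ⟨i, hi⟩ := exists_eq_ciSup_of_finite (f := fun i => ‖G (g i) ω‖)
    exact ⟨⟨g i, mem_range_self i⟩, by rw [pi_norm_eq_ciSup, ← hi]⟩

variable {E : Type*} [PseudoMetricSpace E] {Y : E → Ω → V} {K : ℝ}

/-- Dudley's chaining bound.  The `k`-th link of the chain takes at most as many values as there
are pairs of successive approximations, and the links telescope. -/
lemma hasUpperSubgaussianMGF_chaining (hK : 0 ≤ K)
    (hY : ∀ s t, HasUpperSubgaussianMGF (fun ω => ‖Y s ω - Y t ω‖) (K * dist s t) μ)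
    {u : ι → E} {π : ℕ → ι → E} {δ : ℕ → ℝ} {S : ℝ} (hδ : Tendsto δ atTop (𝓝 0))
    (hπ : ∀ k i, dist (u i) (π k i) ≤ δ k)
    (hS : ∀ m, ∑ k ∈ Finset.range m,
      √(1 + Real.logb 2 (range fun i => (π (k + 1) i, π k i)).ncard) * (δ (k + 1) + δ k) ≤ S) :
    HasUpperSubgaussianMGF (fun ω => ‖fun i => Y (u i) ω - Y (π 0 i) ω‖) (K * S) μ := by
  have hδ0 (k : ℕ) : 0 ≤ δ k := dist_nonneg.trans (hπ k (Classical.arbitrary ι))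
  have hdist {a b : ι → E} {d : ℝ} (hd : ∀ i, dist (a i) (b i) ≤ d) (i : ι) :
      HasUpperSubgaussianMGF (fun ω => ‖Y (a i) ω - Y (b i) ω‖) (K * d) μ :=
    (hY (a i) (b i)).mono_scale (by positivity) (by gcongr; exact hd i)
  have hlink (k : ℕ) := hasUpperSubgaussianMGF_pi_norm
    (G := fun (q : E × E) ω => Y q.1 ω - Y q.2 ω) (g := fun i => (π (k + 1) i, π k i))
    (hdist fun i => (dist_triangle_left _ _ (u i)).trans (add_le_add (hπ (k + 1) i) (hπ k i)))
  have hrest (m : ℕ) := hasUpperSubgaussianMGF_pi_norm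
    (G := fun i ω => Y (u i) ω - Y (π m i) ω) (g := id) (hdist (hπ m))
  have htelescope (m : ℕ) (ω : Ω) : ‖fun i => Y (u i) ω - Y (π 0 i) ω‖ ≤
      ‖fun i => Y (u i) ω - Y (π m i) ω‖ +
        ∑ k ∈ Finset.range m, ‖fun i => Y (π (k + 1) i) ω - Y (π k i) ω‖ := by
    refine le_trans (le_of_eq (congrArg norm ?_))
      ((norm_add_le _ _).trans (add_le_add le_rfl (norm_sum_le _ _)))
    ext i
    rw [Pi.add_apply, Finset.sum_apply, Finset.sum_range_sub (fun k => Y (π k i) ω),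
      sub_add_sub_cancel]
  have hlim : Tendsto (fun m => √(1 + Real.logb 2 (range (id : ι → ι)).ncard) * (K * δ m) +
      K * S) atTop (𝓝 (K * S)) := by
    simpa using ((hδ.const_mul K).const_mul _).add_const (K * S)
  refine HasUpperSubgaussianMGF.of_tendsto hlim (Eventually.of_forall fun m => ?_)
  have hδδ (k : ℕ) : 0 ≤ K * (δ (k + 1) + δ k) := mul_nonneg hK (add_nonneg (hδ0 _) (hδ0 k))
  have hchain := HasUpperSubgaussianMGF.sum (s := Finset.range m) (fun k _ => hlink k)
    fun k _ => mul_nonneg (Real.sqrt_nonneg _) (hδδ k)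
  simp only [mul_left_comm _ K, ← Finset.mul_sum] at hchain
  have hchain_nonneg : 0 ≤ K * ∑ k ∈ Finset.range m,
      √(1 + Real.logb 2 (range fun i => (π (k + 1) i, π k i)).ncard) * (δ (k + 1) + δ k) :=
    mul_nonneg hK (Finset.sum_nonneg fun k _ =>
      mul_nonneg (Real.sqrt_nonneg _) (add_nonneg (hδ0 _) (hδ0 k)))
  have hrest_nonneg := mul_nonneg (Real.sqrt_nonneg (1 + Real.logb 2
    (range (id : ι → ι)).ncard)) (mul_nonneg hK (hδ0 m))
  exact (((hrest m).add hchain hrest_nonneg hchain_nonneg).mono (hrest 0).aemeasurable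
    (htelescope m)).mono_scale (add_nonneg hrest_nonneg hchain_nonneg)
    (by gcongr; exact hS m)

/-- The constant of Dudley's bound for a set whose covering numbers at scale `2 ^ (-k)` are at most
`exp (c * 2 ^ (s * k))`.  It bounds the entropy sum `∑ k, √(1 + log₂ (N_k N_{k+1})) 2 ^ (-k)` by a
geometric series, whose ratio `√(2 ^ s) / 2` is smaller than `1` when `s < 2`. -/
def chainingConst (c s : ℝ) : ℝ :=
  3 / 2 * √(1 + 2 * c * 2 ^ s / Real.log 2) / (1 - √(2 ^ s) / 2)

lemma sqrt_two_rpow_div_two_lt_one {s : ℝ} (hs : s < 2) : √((2 : ℝ) ^ s) / 2 < 1 := by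
  rw [div_lt_one two_pos, Real.sqrt_lt' two_pos, ← Real.rpow_two]
  exact Real.rpow_lt_rpow_of_exponent_lt one_lt_two hs

lemma chainingConst_pos {c s : ℝ} (hc : 0 ≤ c) (hs : s < 2) : 0 < chainingConst c s := by
  have := Real.log_pos one_lt_two
  exact div_pos (by positivity) (sub_pos.2 (sqrt_two_rpow_div_two_lt_one hs))

lemma sum_entropy_le_chainingConst {c s : ℝ} (hc : 0 ≤ c) (hs : 0 ≤ s) (hs2 : s < 2) {N : ℕ → ℝ}
    (hlog : ∀ k, Real.log (N k) ≤ 2 * c * (2 ^ s) ^ (k + 1)) (m : ℕ) :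
    ∑ k ∈ Finset.range m, √(1 + Real.logb 2 (N k)) * ((1 / 2) ^ (k + 1) + (1 / 2) ^ k) ≤
      chainingConst c s := by
  set r := √((2 : ℝ) ^ s) / 2 with hr
  set A := 1 + 2 * c * 2 ^ s / Real.log 2 with hA
  have hlog2 : 0 < Real.log 2 := Real.log_pos one_lt_two
  have hr1 : r < 1 := sqrt_two_rpow_div_two_lt_one hs2
  have hentropy (k : ℕ) : √(1 + Real.logb 2 (N k)) ≤ √A * √(2 ^ s) ^ k := by
    refine Real.sqrt_le_iff.2 ⟨by positivity, ?_⟩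
    rw [mul_pow, ← pow_mul, mul_comm k 2, pow_mul, Real.sq_sqrt (by positivity),
      Real.sq_sqrt (by positivity)]
    have hgrowth : 1 ≤ ((2 : ℝ) ^ s) ^ k := one_le_pow₀ (Real.one_le_rpow one_le_two hs)
    calc 1 + Real.logb 2 (N k) ≤ (2 ^ s) ^ k + 2 * c * (2 ^ s) ^ (k + 1) / Real.log 2 :=
          add_le_add hgrowth (div_le_div_of_nonneg_right (hlog k) hlog2.le)
      _ = A * (2 ^ s) ^ k := by rw [hA]; ring
  calc ∑ k ∈ Finset.range m, √(1 + Real.logb 2 (N k)) * ((1 / 2) ^ (k + 1) + (1 / 2) ^ k)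
      ≤ ∑ k ∈ Finset.range m, 3 / 2 * √A * r ^ k := by
        refine Finset.sum_le_sum fun k _ => ?_
        refine (mul_le_mul_of_nonneg_right (hentropy k) (by positivity)).trans_eq ?_
        rw [hr, div_eq_mul_one_div √(2 ^ s), mul_pow, pow_succ]
        ring
    _ ≤ 3 / 2 * √A * (1 - r)⁻¹ := by
        rw [← Finset.mul_sum, ← tsum_geometric_of_lt_one (by positivity) hr1]
        gcongr
        exact (summable_geometric_of_lt_one (by positivity) hr1).sum_le_tsum _
          fun _ _ => by positivity
    _ = chainingConst c s := (div_eq_mul_inv _ _).symm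

lemma hasUpperSubgaussianMGF_chaining_of_entropy_le {c s D : ℝ} (hc : 0 ≤ c) (hs : 0 ≤ s)
    (hs2 : s < 2) (hK : 0 ≤ K)
    (hY : ∀ s t, HasUpperSubgaussianMGF (fun ω => ‖Y s ω - Y t ω‖) (K * dist s t) μ)
    {u : ι → E} {t₀ : E} (hD : ∀ i, dist (u i) t₀ ≤ D)
    (hcover : ∀ k : ℕ, ∃ C : Finset E, (∀ i, ∃ t ∈ C, dist (u i) t ≤ D * (1 / 2) ^ k) ∧
      Real.log C.card ≤ c * (2 ^ s) ^ k) :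
    HasUpperSubgaussianMGF (fun ω => ‖fun i => Y (u i) ω - Y t₀ ω‖)
      (K * (D * chainingConst c s)) μ := by
  obtain ⟨π, hπ₀, hπ, hlogπ⟩ := exists_approximating_sequence hc hD hcover
  have hD0 : 0 ≤ D := dist_nonneg.trans (hD (Classical.arbitrary ι))
  have hlogpair (k : ℕ) : Real.log (range fun i => (π (k + 1) i, π k i)).ncard ≤
      2 * c * (2 ^ s) ^ (k + 1) := by
    have hmono : ((2 : ℝ) ^ s) ^ k ≤ (2 ^ s) ^ (k + 1) :=
      pow_le_pow_right₀ (Real.one_le_rpow one_le_two hs) k.le_succ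
    linarith [log_ncard_range_prodMk_le (π (k + 1)) (π k), hlogπ (k + 1), hlogπ k,
      mul_le_mul_of_nonneg_left hmono hc]
  have hlim : Tendsto (fun k : ℕ => D * (1 / 2 : ℝ) ^ k) atTop (𝓝 0) := by
    simpa using (tendsto_pow_atTop_nhds_zero_of_lt_one (by norm_num)
      (by norm_num : (1 / 2 : ℝ) < 1)).const_mul D
  have hchain := hasUpperSubgaussianMGF_chaining (S := D * chainingConst c s) hK hY hlim hπ
    fun m => by
      simp only [← mul_add, mul_left_comm _ D, ← Finset.mul_sum]
      exact mul_le_mul_of_nonneg_left (sum_entropy_le_chainingConst hc hs hs2 hlogpair m) hD0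
  simpa only [hπ₀] using hchain

end Chaining

section Rademacher

variable {Ω : Type*} {mΩ : MeasurableSpace Ω} {μ : Measure Ω} {ι : Type*} [Fintype ι]

lemma hasUpperSubgaussianMGF_abs_sum_mul {ε : ι → Ω → ℝ} (hε : iIndepFun ε μ)
    (hsub : ∀ i, HasSubgaussianMGF (ε i) 1 μ) (a : ι → ℝ) :
    HasUpperSubgaussianMGF (fun ω => |∑ i, ε i ω * a i|) √((∑ i, a i ^ 2) / 2) μ := by
  have hterm (i : ι) : HasSubgaussianMGF (fun ω => ε i ω * a i) (‖a i‖₊ ^ 2) μ := by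
    convert (hsub i).const_mul (a i) using 1
    · simp only [mul_comm]
    · exact NNReal.eq (show ‖a i‖ ^ 2 = a i ^ 2 * 1 by simp)
  have hindep : iIndepFun (fun i ω => ε i ω * a i) μ :=
    hε.comp (fun i x => x * a i) fun i => measurable_id.mul_const _
  have h := hasUpperSubgaussianMGF_abs
    (HasSubgaussianMGF.sum_of_iIndepFun hindep (s := Finset.univ) fun i _ => hterm i)
  simpa only [NNReal.coe_sum, NNReal.coe_pow, coe_nnnorm, Real.norm_eq_abs, sq_abs] using h

lemma hasUpperSubgaussianMGF_norm_sum_smul {ε : ι → Ω → ℝ} (hε : iIndepFun ε μ)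
    (hsub : ∀ i, HasSubgaussianMGF (ε i) 1 μ) (v : EuclideanSpace ℂ ι) :
    HasUpperSubgaussianMGF (fun ω => ‖∑ i, ε i ω • v i‖) ‖v‖ μ := by
  have hre := hasUpperSubgaussianMGF_abs_sum_mul hε hsub fun i => (v i).re
  have him := hasUpperSubgaussianMGF_abs_sum_mul hε hsub fun i => (v i).im
  have hε_meas (i : ι) : AEMeasurable (fun ω => ε i ω • v i) μ :=
    (hsub i).aemeasurable.smul_const _
  have hscale (x y : ℝ) (hx : 0 ≤ x) (hy : 0 ≤ y) : √(x / 2) + √(y / 2) ≤ √(x + y) := by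
    refine Real.le_sqrt_of_sq_le ?_
    nlinarith [Real.sq_sqrt (div_nonneg hx two_pos.le), Real.sq_sqrt (div_nonneg hy two_pos.le),
      sq_nonneg (√(x / 2) - √(y / 2))]
  have hnorm : ‖v‖ = √(∑ i, (v i).re ^ 2 + ∑ i, (v i).im ^ 2) := by
    simp only [EuclideanSpace.norm_eq, ← Finset.sum_add_distrib, Complex.sq_norm,
      Complex.normSq_apply, ← sq]
  refine ((hre.add him (Real.sqrt_nonneg _) (Real.sqrt_nonneg _)).mono
    (Finset.aemeasurable_fun_sum _ fun i _ => hε_meas i).norm fun ω => ?_).mono_scale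
    (by positivity) (hnorm ▸ hscale _ _ (by positivity) (by positivity))
  simpa using Complex.norm_le_abs_re_add_abs_im (∑ i, ε i ω • v i)

/-- The sign `±1` encoded by a Boolean. -/
def sign (b : Bool) : ℝ := if b then 1 else -1

/-- The law of a family of independent uniform signs, encoded as Booleans. -/
def signLaw (ι : Type*) [Fintype ι] : Measure (ι → Bool) :=
  Measure.pi fun _ => (PMF.uniformOfFintype Bool).toMeasure

instance : IsProbabilityMeasure (signLaw ι) := by
  unfold signLaw; infer_instance

lemma hasSubgaussianMGF_sign_eval (i : ι) :
    HasSubgaussianMGF (fun σ : ι → Bool => sign (σ i)) 1 (signLaw ι) := by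
  have hsign (b : Bool) : sign b ∈ Icc (-1 : ℝ) 1 := by cases b <;> simp [sign]
  have hmean : ∫ b, sign b ∂(PMF.uniformOfFintype Bool).toMeasure = 0 := by
    simp [PMF.integral_eq_sum, sign]
  have hmean_eval : ∫ σ, sign (σ i) ∂signLaw ι = 0 :=
    (integral_comp_eval (f := sign) (μ := fun _ : ι => (PMF.uniformOfFintype Bool).toMeasure)
      (measurable_of_countable sign).aestronglyMeasurable).trans hmean
  have h := hasSubgaussianMGF_of_mem_Icc_of_integral_eq_zero (μ := signLaw ι)
    (X := fun σ => sign (σ i)) (measurable_of_countable _).aemeasurable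
    (ae_of_all _ fun σ => hsign (σ i)) hmean_eval
  convert h
  rw [← NNReal.coe_inj]
  norm_num

lemma iIndepFun_sign_eval : iIndepFun (fun (i : ι) (σ : ι → Bool) => sign (σ i)) (signLaw ι) :=
  iIndepFun_pi fun _ => (measurable_of_countable sign).aemeasurable

lemma hasUpperSubgaussianMGF_norm_sum_sign_smul (v : EuclideanSpace ℂ ι) :
    HasUpperSubgaussianMGF (fun σ => ‖∑ i, sign (σ i) • v i‖) ‖v‖ (signLaw ι) :=
  hasUpperSubgaussianMGF_norm_sum_smul iIndepFun_sign_eval hasSubgaussianMGF_sign_eval v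

end Rademacher

section Symmetrization

namespace HasUpperSubgaussianMGF

variable {Ω Θ : Type*} {mΩ : MeasurableSpace Ω} {mΘ : MeasurableSpace Θ} {μ : Measure Ω}
  {ν : Measure Θ} {Y : Ω → ℝ} {B τ : ℝ}

lemma comp_measurePreserving (hY : HasUpperSubgaussianMGF Y τ μ) {f : Θ → Ω}
    (hf : MeasurePreserving f ν μ) : HasUpperSubgaussianMGF (fun θ => Y (f θ)) τ ν where
  integrable_exp_mul l hl := hf.integrable_comp_of_integrable (hY.integrable_exp_mul l hl)
  mgf_le l hl := by
    have hexp : AEStronglyMeasurable (fun ω => Real.exp (l * Y ω)) (ν.map f) := by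
      rw [hf.map_eq]
      exact (hY.integrable_exp_mul l hl).aestronglyMeasurable
    refine le_of_eq_of_le ?_ (hY.mgf_le l hl)
    rw [mgf, mgf, ← hf.map_eq, integral_map hf.aemeasurable hexp]

lemma of_measurePreserving_family [IsProbabilityMeasure μ] [IsProbabilityMeasure ν]
    {T : Θ → Ω → Ω} (hT : ∀ θ, MeasurePreserving (T θ) μ μ)
    (hmeas : Measurable Y) (hYT : Measurable fun q : Ω × Θ => Y (T q.2 q.1))
    (hbound : ∀ ω, Y ω ≤ B) (hY : ∀ ω, HasUpperSubgaussianMGF (fun θ => Y (T θ ω)) τ ν) :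
    HasUpperSubgaussianMGF Y τ μ := by
  have hexp (l : ℝ) (hl : 0 ≤ l) (ω : Ω) : Real.exp (l * Y ω) ≤ Real.exp (l * B) :=
    Real.exp_le_exp.2 (mul_le_mul_of_nonneg_left (hbound ω) hl)
  have hint (l : ℝ) (hl : 0 ≤ l) : Integrable (fun ω => Real.exp (l * Y ω)) μ :=
    integrable_exp_mul_of_le hmeas.aemeasurable (integrable_const _) (hexp l hl)
  refine ⟨hint, fun l hl => ?_⟩
  have hprod : Integrable (fun q : Ω × Θ => Real.exp (l * Y (T q.2 q.1))) (μ.prod ν) :=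
    integrable_exp_mul_of_le hYT.aemeasurable (integrable_const _) fun _ => hexp l hl _
  have hinvariant (θ : Θ) : ∫ ω, Real.exp (l * Y (T θ ω)) ∂μ = mgf Y μ l := by
    rw [mgf, ← integral_map (φ := T θ) (f := fun ω => Real.exp (l * Y ω)) (hT θ).aemeasurable
      (hmeas.const_mul l).exp.aestronglyMeasurable, (hT θ).map_eq]
  calc mgf Y μ l = ∫ θ, ∫ ω, Real.exp (l * Y (T θ ω)) ∂μ ∂ν := by simp [hinvariant]
    _ = ∫ ω, mgf (fun θ => Y (T θ ω)) ν l ∂μ := (integral_integral_swap hprod).symm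
    _ ≤ ∫ _, 2 * Real.exp ((l * τ) ^ 2) ∂μ :=
        integral_mono hprod.integral_prod_left (integrable_const _) fun ω => (hY ω).mgf_le l hl
    _ = 2 * Real.exp ((l * τ) ^ 2) := by simp

variable {V : Type*} [NormedAddCommGroup V] [NormedSpace ℝ V] [CompleteSpace V]

lemma norm_sub_integral [IsProbabilityMeasure μ] {S : Ω → V} (hS : StronglyMeasurable S)
    (hB : ∀ ω, ‖S ω‖ ≤ B)
    (hsub : HasUpperSubgaussianMGF (fun q : Ω × Ω => ‖S q.1 - S q.2‖) τ (μ.prod μ)) :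
    HasUpperSubgaussianMGF (fun ω => ‖S ω - ∫ ω', S ω' ∂μ‖) τ μ := by
  have hdiff (ω : Ω) : Integrable (fun ω' => S ω - S ω') μ :=
    (integrable_const _).sub (.of_bound hS.aestronglyMeasurable B (ae_of_all _ hB))
  have hexp (l : ℝ) (hl : 0 ≤ l) (ω : Ω) : Integrable (fun ω' => Real.exp (l * ‖S ω - S ω'‖)) μ :=
    integrable_exp_mul_of_le (hdiff ω).norm.aemeasurable (integrable_const (Real.exp (l * (B + B))))
      fun ω' => Real.exp_le_exp.2 (mul_le_mul_of_nonneg_left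
        ((norm_sub_le _ _).trans (add_le_add (hB ω) (hB ω'))) hl)
  have hjensen (l : ℝ) (hl : 0 ≤ l) (ω : Ω) :
      Real.exp (l * ‖S ω - ∫ ω', S ω' ∂μ‖) ≤ ∫ ω', Real.exp (l * ‖S ω - S ω'‖) ∂μ := by
    have hnorm : ‖S ω - ∫ ω', S ω' ∂μ‖ ≤ ∫ ω', ‖S ω - S ω'‖ ∂μ := by
      refine le_of_eq_of_le (congrArg norm ?_) (norm_integral_le_integral_norm _)
      rw [integral_sub (integrable_const _)
        (.of_bound hS.aestronglyMeasurable B (ae_of_all _ hB))]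
      simp
    refine (Real.exp_le_exp.2 (mul_le_mul_of_nonneg_left hnorm hl)).trans ?_
    rw [← integral_const_mul]
    exact convexOn_exp.map_integral_le Real.continuous_exp.continuousOn isClosed_univ
      (ae_of_all _ fun _ => mem_univ _) ((hdiff ω).norm.const_mul l) (hexp l hl ω)
  have hprod (l : ℝ) (hl : 0 ≤ l) := hsub.integrable_exp_mul l hl
  have hint (l : ℝ) (hl : 0 ≤ l) :
      Integrable (fun ω => Real.exp (l * ‖S ω - ∫ ω', S ω' ∂μ‖)) μ :=
    integrable_exp_mul_of_le (hS.sub stronglyMeasurable_const).norm.measurable.aemeasurable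
      (hprod l hl).integral_prod_left (hjensen l hl)
  refine ⟨hint, fun l hl => (integral_mono (hint l hl) (hprod l hl).integral_prod_left
    (hjensen l hl)).trans ?_⟩
  rw [← integral_prod _ (hprod l hl)]
  exact hsub.mgf_le l hl

end HasUpperSubgaussianMGF

variable {Z : Type*} {mZ : MeasurableSpace Z} {ρ : Measure Z} [IsProbabilityMeasure ρ]
  {ι : Type*} [Fintype ι]

/-- Exchange of the two entries in the pairs of negative sign. -/
def swapBySigns (σ : ι → Bool) (w : ι → Z × Z) (i : ι) : Z × Z :=
  if σ i then w i else (w i).swap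

lemma measurePreserving_swapBySigns (σ : ι → Bool) :
    MeasurePreserving (swapBySigns σ) (Measure.pi fun _ : ι => ρ.prod ρ)
      (Measure.pi fun _ => ρ.prod ρ) := by
  refine measurePreserving_pi _ _ (f := fun i (q : Z × Z) => if σ i then q else q.swap) fun i => ?_
  cases σ i
  · simpa using Measure.measurePreserving_swap
  · exact MeasurePreserving.id _

variable {V : Type*} [NormedAddCommGroup V] {Φ : Z → V} {B τ : ℝ}

lemma stronglyMeasurable_sum_sub (hΦ : StronglyMeasurable Φ) :
    StronglyMeasurable fun w : ι → Z × Z => ∑ i, (Φ (w i).1 - Φ (w i).2) :=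
  Finset.stronglyMeasurable_fun_sum _ fun i _ =>
    (hΦ.comp_measurable (measurable_fst.comp (measurable_pi_apply i))).sub
      (hΦ.comp_measurable (measurable_snd.comp (measurable_pi_apply i)))

variable [NormedSpace ℝ V]

lemma sum_swapBySigns (σ : ι → Bool) (w : ι → Z × Z) :
    ∑ i, (Φ (swapBySigns σ w i).1 - Φ (swapBySigns σ w i).2) =
      ∑ i, sign (σ i) • (Φ (w i).1 - Φ (w i).2) := by
  refine Finset.sum_congr rfl fun i _ => ?_
  cases h : σ i <;> simp [swapBySigns, sign, h]

lemma hasUpperSubgaussianMGF_norm_sum_sub (hΦ : StronglyMeasurable Φ) (hB : ∀ z, ‖Φ z‖ ≤ B)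
    (hsign : ∀ w : ι → Z × Z, HasUpperSubgaussianMGF
      (fun σ => ‖∑ i, sign (σ i) • (Φ (w i).1 - Φ (w i).2)‖) τ (signLaw ι)) :
    HasUpperSubgaussianMGF (fun w : ι → Z × Z => ‖∑ i, (Φ (w i).1 - Φ (w i).2)‖) τ
      (Measure.pi fun _ => ρ.prod ρ) := by
  have hmeas := (stronglyMeasurable_sum_sub (ι := ι) hΦ).norm.measurable
  refine HasUpperSubgaussianMGF.of_measurePreserving_family (T := swapBySigns)
    (B := Fintype.card ι * (B + B)) (ν := signLaw ι)
    measurePreserving_swapBySigns hmeas ?_ (fun w => ?_) fun w => ?_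
  · exact measurable_from_prod_countable_left fun σ =>
      hmeas.comp (measurePreserving_swapBySigns (ρ := ρ) σ).measurable
  · refine (norm_sum_le_of_le _ fun i _ => (norm_sub_le _ _).trans
      (add_le_add (hB _) (hB _))).trans_eq ?_
    simp [mul_add]
  · simpa only [sum_swapBySigns] using hsign w

lemma hasUpperSubgaussianMGF_norm_sum_sub_integral [CompleteSpace V] (hΦ : StronglyMeasurable Φ)
    (hB : ∀ z, ‖Φ z‖ ≤ B)
    (hsign : ∀ w : ι → Z × Z, HasUpperSubgaussianMGF
      (fun σ => ‖∑ i, sign (σ i) • (Φ (w i).1 - Φ (w i).2)‖) τ (signLaw ι)) :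
    HasUpperSubgaussianMGF (fun z => ‖∑ i, Φ (z i) - (Fintype.card ι : ℝ) • ∫ z, Φ z ∂ρ‖) τ
      (Measure.pi fun _ : ι => ρ) := by
  have hΦi (i : ι) : Integrable (fun z : ι → Z => Φ (z i)) (Measure.pi fun _ => ρ) :=
    .of_bound (hΦ.comp_measurable (measurable_pi_apply i)).aestronglyMeasurable B
      (ae_of_all _ fun z => hB (z i))
  have hmean : ∫ z : ι → Z, ∑ i, Φ (z i) ∂(Measure.pi fun _ => ρ) =
      (Fintype.card ι : ℝ) • ∫ z, Φ z ∂ρ := by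
    rw [integral_finsetSum _ fun i _ => hΦi i]
    simp only [integral_comp_eval (μ := fun _ : ι => ρ) hΦ.aestronglyMeasurable, Finset.sum_const,
      Finset.card_univ, Nat.cast_smul_eq_nsmul]
  rw [← hmean]
  refine HasUpperSubgaussianMGF.norm_sub_integral (B := Fintype.card ι * B)
    (Finset.stronglyMeasurable_fun_sum _ fun i _ => hΦ.comp_measurable (measurable_pi_apply i))
    (fun z => (norm_sum_le_of_le _ fun i _ => hB (z i)).trans_eq (by simp)) ?_
  have h := (hasUpperSubgaussianMGF_norm_sum_sub (ρ := ρ) hΦ hB hsign).comp_measurePreserving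
    (measurePreserving_arrowProdEquivProdArrow Z Z ι (fun _ => ρ) (fun _ => ρ)).symm
  simp only [Finset.sum_sub_distrib] at h
  exact h

end Symmetrization

section EmpiricalFeatures

lemma exists_finset_isCover_card_le_exp {E : Type*} [PseudoEMetricSpace E] {r : ℝ≥0} {S : Set E}
    {a : ℝ} (h : ENNReal.log (Metric.externalCoveringNumber r S : ℝ≥0∞) ≤ (a : EReal)) :
    ∃ C : Finset E, Metric.IsCover r S (C : Set E) ∧ (C.card : ℝ) ≤ Real.exp a := by
  rw [← Real.log_exp a, ← ENNReal.log_ofReal_of_pos (Real.exp_pos a),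
    ENNReal.log_le_log_iff] at h
  have hcover : ∃ C : Set E, Metric.IsCover r S C ∧
      C.encard = Metric.externalCoveringNumber r S := by
    have : Nonempty {C : Set E // Metric.IsCover r S C} := ⟨⟨S, Metric.IsCover.rfl⟩⟩
    obtain ⟨C, hC⟩ := ciInf_mem fun C : {C : Set E // Metric.IsCover r S C} => C.1.encard
    exact ⟨C.1, C.2, hC.trans (by rw [Metric.externalCoveringNumber, iInf_subtype'])⟩
  obtain ⟨C, hC, hcard⟩ := hcover
  have hfin : C.Finite := by
    refine Set.encard_ne_top_iff.1 fun htop => ?_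
    rw [← hcard, htop] at h
    simp at h
  refine ⟨hfin.toFinset, by rwa [hfin.coe_toFinset], ?_⟩
  rw [← hcard, hfin.encard_eq_coe_toFinset_card] at h
  exact (ENNReal.ofReal_le_ofReal_iff (Real.exp_pos a).le).1 (by simpa using h)

variable {X : Type*} {H : Set (X → ℝ)} {c s : ℝ}

/-- The entropy condition `log N₂(H, ε) ≤ c ε^{-s}` for all `ε > 0`. -/
def HasEmpiricalEntropyBound (H : Set (X → ℝ)) (c s : ℝ) : Prop :=
  ∀ ε : ℝ≥0, 0 < ε →
    ENNReal.log (empiricalCoveringNumber H ε : ℝ≥0∞) ≤ ((c * (ε : ℝ) ^ (-s) : ℝ) : EReal)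

lemma HasEmpiricalEntropyBound.exists_finset_cover (hH : HasEmpiricalEntropyBound H c s) {n : ℕ}
    (x : Fin n → X) (k : ℕ) :
    ∃ C : Finset (EuclideanSpace ℝ (Fin n)), (C.card : ℝ) ≤ Real.exp (c * (2 ^ s) ^ k) ∧
      ∀ f ∈ H, ∃ v ∈ C, dist (WithLp.toLp 2 fun i => f (x i)) v ≤ (1 / 2) ^ k * √n := by
  have hrpow : (((1 / 2 : ℝ≥0) ^ k : ℝ≥0) : ℝ) ^ (-s) = ((2 : ℝ) ^ s) ^ k := by
    push_cast
    rw [← Real.rpow_natCast, ← Real.rpow_mul (by norm_num), mul_comm, Real.rpow_mul (by norm_num),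
      one_div, Real.inv_rpow two_pos.le, Real.rpow_neg two_pos.le, inv_inv, Real.rpow_natCast]
  have hbound := hH ((1 / 2) ^ k) (by positivity)
  rw [hrpow] at hbound
  obtain ⟨C, hC, hcard⟩ := exists_finset_isCover_card_le_exp
    ((ENNReal.log_monotone (ENat.toENNReal_mono (le_iSup₂_of_le n x le_rfl))).trans hbound)
  refine ⟨C, hcard, fun f hf => ?_⟩
  obtain ⟨v, hv, hdist⟩ := hC (mem_image_of_mem _ hf)
  have hdist' : edist (WithLp.toLp 2 fun i => f (x i)) v ≤
      (((1 / 2) ^ k * NNReal.sqrt n : ℝ≥0) : ℝ≥0∞) := hdist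
  rw [edist_nndist, ENNReal.coe_le_coe, ← NNReal.coe_le_coe, coe_nndist] at hdist'
  exact ⟨v, hv, by simpa using hdist'⟩

variable {φ : ℝ → ℂ} {n : ℕ}

/-- The differences `φ (yⱼ - aⱼ) - φ (y'ⱼ - a'ⱼ)` along the pairs `((xⱼ, yⱼ), (x'ⱼ, y'ⱼ))`, where
`a` lists the predictions at `x₁, …, xₙ, x'₁, …, x'ₙ`. -/
def pairedFeature (φ : ℝ → ℂ) (w : Fin n → (X × ℝ) × (X × ℝ))
    (a : EuclideanSpace ℝ (Fin (n + n))) : EuclideanSpace ℂ (Fin n) :=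
  WithLp.toLp 2 fun j =>
    φ ((w j).1.2 - a (Fin.castAdd n j)) - φ ((w j).2.2 - a (Fin.natAdd n j))

lemma norm_pairedFeature_le (hφ : ∀ t, ‖φ t‖ ≤ 1) (w : Fin n → (X × ℝ) × (X × ℝ))
    (a : EuclideanSpace ℝ (Fin (n + n))) : ‖pairedFeature φ w a‖ ≤ 2 * √n := by
  rw [EuclideanSpace.norm_eq]
  refine Real.sqrt_le_iff.2 ⟨by positivity, ?_⟩
  calc ∑ j, ‖pairedFeature φ w a j‖ ^ 2 ≤ ∑ _j : Fin n, ((1 : ℝ) + 1) ^ 2 :=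
        Finset.sum_le_sum fun j _ => pow_le_pow_left₀ (norm_nonneg _)
          ((norm_sub_le _ _).trans (add_le_add (hφ _) (hφ _))) 2
    _ = (2 * √n) ^ 2 := by
        rw [mul_pow, Real.sq_sqrt n.cast_nonneg, Finset.sum_const, Finset.card_univ,
          Fintype.card_fin, nsmul_eq_mul]
        ring

lemma dist_pairedFeature_le (hφ : LipschitzWith 1 φ) (w : Fin n → (X × ℝ) × (X × ℝ))
    (a b : EuclideanSpace ℝ (Fin (n + n))) :
    dist (pairedFeature φ w a) (pairedFeature φ w b) ≤ √2 * dist a b := by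
  have hlip (y t t' : ℝ) : ‖φ (y - t) - φ (y - t')‖ ≤ |t - t'| := by
    have h := hφ.dist_le_mul (y - t) (y - t')
    rwa [NNReal.coe_one, one_mul, dist_sub_left, dist_eq_norm, Real.dist_eq] at h
  have hcoord (j : Fin n) : ‖pairedFeature φ w a j - pairedFeature φ w b j‖ ^ 2 ≤
      2 * ((a (Fin.castAdd n j) - b (Fin.castAdd n j)) ^ 2 +
        (a (Fin.natAdd n j) - b (Fin.natAdd n j)) ^ 2) := by
    have hnorm : ‖pairedFeature φ w a j - pairedFeature φ w b j‖ ≤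
        |a (Fin.castAdd n j) - b (Fin.castAdd n j)| +
          |a (Fin.natAdd n j) - b (Fin.natAdd n j)| := by
      refine (norm_sub_le_of_le (hlip (w j).1.2 _ _) (hlip (w j).2.2 _ _)).trans' (le_of_eq ?_)
      simp only [pairedFeature]
      congr 1
      ring
    refine (pow_le_pow_left₀ (norm_nonneg _) hnorm 2).trans ?_
    simpa only [sq_abs] using add_sq_le (a := |a (Fin.castAdd n j) - b (Fin.castAdd n j)|)
      (b := |a (Fin.natAdd n j) - b (Fin.natAdd n j)|)
  rw [EuclideanSpace.dist_eq, EuclideanSpace.dist_eq, ← Real.sqrt_mul two_pos.le]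
  refine Real.sqrt_le_sqrt ?_
  simp only [dist_eq_norm, Real.norm_eq_abs, sq_abs]
  rw [Fin.sum_univ_add, ← Finset.sum_add_distrib, Finset.mul_sum]
  exact Finset.sum_le_sum fun j _ => hcoord j

variable {ι : Type*} [Fintype ι] [Nonempty ι]

/-- The predictions `f x₁, …, f xₙ, f x'₁, …, f x'ₙ` along pairs of observations. -/
def pairedPredictions (w : Fin n → (X × ℝ) × (X × ℝ)) (f : X → ℝ) :
    EuclideanSpace ℝ (Fin (n + n)) :=
  WithLp.toLp 2 fun j => f (Fin.append (fun j => (w j).1.1) (fun j => (w j).2.1) j)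

lemma exists_finset_cover_pairedFeature {ι : Type*} [Nonempty ι]
    (hH : HasEmpiricalEntropyBound H c s) (hφ : LipschitzWith 1 φ)
    (w : Fin n → (X × ℝ) × (X × ℝ)) {u : ι → X → ℝ} (hu : ∀ i, u i ∈ H) (k : ℕ) :
    ∃ C : Finset (EuclideanSpace ℂ (Fin n)),
      (∀ i, ∃ t ∈ C, dist (pairedFeature φ w (pairedPredictions w (u i))) t ≤
        2 * √n * (1 / 2) ^ k) ∧ Real.log C.card ≤ c * (2 ^ s) ^ k := by
  classical
  obtain ⟨C, hcard, hC⟩ :=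
    hH.exists_finset_cover (Fin.append (fun j => (w j).1.1) fun j => (w j).2.1) k
  have himage (i : ι) : ∃ t ∈ C.image (pairedFeature φ w),
      dist (pairedFeature φ w (pairedPredictions w (u i))) t ≤ 2 * √n * (1 / 2) ^ k := by
    obtain ⟨a, ha, hdist⟩ := hC (u i) (hu i)
    refine ⟨_, Finset.mem_image_of_mem _ ha, (dist_pairedFeature_le hφ w _ a).trans
      ((mul_le_mul_of_nonneg_left hdist (Real.sqrt_nonneg 2)).trans_eq ?_)⟩
    rw [Nat.cast_add, ← two_mul, Real.sqrt_mul two_pos.le]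
    linear_combination (√n * (1 / 2) ^ k) * Real.mul_self_sqrt two_pos.le
  obtain ⟨t, ht, -⟩ := himage (Classical.arbitrary ι)
  have hpos : 0 < ((C.image (pairedFeature φ w)).card : ℝ) :=
    Nat.cast_pos.2 (Finset.card_pos.2 ⟨t, ht⟩)
  exact ⟨_, himage, (Real.log_le_iff_le_exp hpos).2
    ((Nat.cast_le.2 Finset.card_image_le).trans hcard)⟩

lemma hasUpperSubgaussianMGF_norm_sum_sign_feature (hc : 0 ≤ c) (hs : 0 ≤ s) (hs2 : s < 2)
    (hH : HasEmpiricalEntropyBound H c s) (hφ1 : ∀ t, ‖φ t‖ ≤ 1) (hφ : LipschitzWith 1 φ)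
    {u : ι → X → ℝ} (hu : ∀ i, u i ∈ H) (w : Fin n → (X × ℝ) × (X × ℝ)) :
    HasUpperSubgaussianMGF
      (fun σ => ‖∑ j, sign (σ j) • ((fun i => φ ((w j).1.2 - u i (w j).1.1)) -
        fun i => φ ((w j).2.2 - u i (w j).2.1))‖)
      (2 * √n * chainingConst c s) (signLaw (Fin n)) := by
  let v (i : ι) := pairedFeature φ w (pairedPredictions w (u i))
  have hsubgaussian (a b : EuclideanSpace ℂ (Fin n)) : HasUpperSubgaussianMGF
      (fun σ => ‖∑ j, sign (σ j) • a j - ∑ j, sign (σ j) • b j‖) (1 * dist a b)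
      (signLaw (Fin n)) := by
    simpa only [one_mul, dist_eq_norm, ← Finset.sum_sub_distrib, ← smul_sub, PiLp.sub_apply]
      using hasUpperSubgaussianMGF_norm_sum_sign_smul (a - b)
  have h := hasUpperSubgaussianMGF_chaining_of_entropy_le (μ := signLaw (Fin n))
    (Y := fun a σ => ∑ j, sign (σ j) • a j) (t₀ := 0) hc hs hs2 zero_le_one hsubgaussian
    (fun i => (dist_zero_right (v i)).trans_le (norm_pairedFeature_le hφ1 w _))
    (exists_finset_cover_pairedFeature hH hφ w hu)
  rw [one_mul] at h
  convert h using 2 with σ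
  congr 1
  ext i
  simp only [v, pairedPredictions, pairedFeature, Finset.sum_apply, Pi.smul_apply, Pi.sub_apply,
    PiLp.zero_apply, smul_zero, Finset.sum_const_zero, sub_zero, Fin.append_left,
    Fin.append_right]

lemma hasUpperSubgaussianMGF_norm_sum_feature [MeasurableSpace X] {ρ : Measure (X × ℝ)}
    [IsProbabilityMeasure ρ] (hc : 0 ≤ c) (hs : 0 ≤ s) (hs2 : s < 2)
    (hH : HasEmpiricalEntropyBound H c s) (hφ1 : ∀ t, ‖φ t‖ ≤ 1) (hφ : LipschitzWith 1 φ)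
    {u : ι → X → ℝ} (hu : ∀ i, u i ∈ H) (hum : ∀ i, Measurable (u i)) :
    HasUpperSubgaussianMGF
      (fun z => ‖fun i => ∑ j, φ ((z j).2 - u i (z j).1) -
        (n : ℂ) * ∫ q, φ (q.2 - u i q.1) ∂ρ‖)
      (2 * √n * chainingConst c s) (Measure.pi fun _ : Fin n => ρ) := by
  have hmeas : Measurable fun (q : X × ℝ) (i : ι) => φ (q.2 - u i q.1) :=
    measurable_pi_lambda _ fun i => hφ.continuous.measurable.comp
      (measurable_snd.sub ((hum i).comp measurable_fst))
  have hbound (q : X × ℝ) : ‖fun i => φ (q.2 - u i q.1)‖ ≤ 1 :=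
    (pi_norm_le_iff_of_nonneg zero_le_one).2 fun i => hφ1 _
  have h := hasUpperSubgaussianMGF_norm_sum_sub_integral (ρ := ρ) hmeas.stronglyMeasurable hbound
    (hasUpperSubgaussianMGF_norm_sum_sign_feature hc hs hs2 hH hφ1 hφ hu (n := n))
  have hint : Integrable (fun (q : X × ℝ) (i : ι) => φ (q.2 - u i q.1)) ρ :=
    .of_bound hmeas.aestronglyMeasurable 1 (ae_of_all _ hbound)
  convert h using 2 with z
  congr 1
  ext i
  simp [eval_integral fun i => hint.eval i]

end EmpiricalFeatures

section InformationPotential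

lemma integral_charFun_comm (μ ν : Measure ℝ) [IsFiniteMeasure μ] [IsFiniteMeasure ν] :
    ∫ x, charFun ν x ∂μ = ∫ ξ, charFun μ ξ ∂ν := by
  have hint : Integrable (Function.uncurry fun x ξ : ℝ => Complex.exp (ξ * x * Complex.I))
      (μ.prod ν) := by
    refine .of_bound (C := 1) (by fun_prop) (ae_of_all _ fun q => ?_)
    simp [Function.uncurry, ← Complex.ofReal_mul, Complex.norm_exp_ofReal_mul_I]
  simp only [charFun_apply_real]
  rw [integral_integral_swap (by simpa only [mul_comm] using hint)]
  simp only [mul_comm]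

lemma charFun_conv_map_neg (μ : Measure ℝ) [IsFiniteMeasure μ] (ξ : ℝ) :
    charFun (μ ∗ μ.map Neg.neg) ξ = ((‖charFun μ ξ‖ ^ 2 : ℝ) : ℂ) := by
  have hneg : charFun (μ.map Neg.neg) ξ = charFun μ (-ξ) := by
    simpa using charFun_map_mul (μ := μ) (-1) ξ
  rw [charFun_conv, hneg, charFun_neg, Complex.mul_conj']
  push_cast
  rfl

/-- The value `G_h(0)`, which normalizes the spectral measure of `G_h` to a probability measure. -/
def kernelScale (h : ℝ) : ℝ := 1 / (Real.sqrt (2 * Real.pi) * h)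

/-- The normalized spectral measure of `G_h`. -/
def frequencyLaw (h : ℝ) : Measure ℝ := gaussianReal 0 (Real.toNNReal (1 / h ^ 2))

instance (h : ℝ) : IsProbabilityMeasure (frequencyLaw h) := by
  unfold frequencyLaw; infer_instance

variable {h : ℝ}

lemma kernelScale_pos (hh : 0 < h) : 0 < kernelScale h := by
  unfold kernelScale
  positivity

lemma gaussKernel_eq_charFun (h t : ℝ) :
    (gaussKernel h t : ℂ) = kernelScale h * charFun (frequencyLaw h) t := by
  rw [frequencyLaw, charFun_gaussianReal, Real.coe_toNNReal _ (by positivity), gaussKernel,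
    kernelScale]
  push_cast
  congr 2
  ring

/-- The information potential `∬ G_h (s - t) dμ(s) dμ(t)` of an error law `μ`: the information
error of `f` is minus the potential of the law of `Y - f(X)`. -/
def informationPotential (h : ℝ) (μ : Measure ℝ) : ℝ := ∫ s, ∫ t, gaussKernel h (s - t) ∂μ ∂μ

lemma informationPotential_eq_integral_sq_norm_charFun (h : ℝ) (μ : Measure ℝ)
    [IsFiniteMeasure μ] :
    informationPotential h μ = kernelScale h * ∫ ξ, ‖charFun μ ξ‖ ^ 2 ∂frequencyLaw h := by
  have hint : Integrable (charFun (frequencyLaw h)) (μ ∗ μ.map Neg.neg) :=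
    .of_bound stronglyMeasurable_charFun.aestronglyMeasurable 1
      (ae_of_all _ norm_charFun_le_one)
  have hneg (g : ℝ → ℝ) : ∫ t, g t ∂(μ.map Neg.neg) = ∫ t, g (-t) ∂μ :=
    integral_map_equiv (MeasurableEquiv.neg ℝ) g
  refine Complex.ofReal_injective ?_
  calc (informationPotential h μ : ℂ)
      = ∫ s, ∫ t, kernelScale h * charFun (frequencyLaw h) (s + t) ∂(μ.map Neg.neg) ∂μ := by
        simp only [informationPotential, ← gaussKernel_eq_charFun, integral_complex_ofReal,
          hneg, sub_eq_add_neg]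
    _ = kernelScale h * ∫ x, charFun (frequencyLaw h) x ∂(μ ∗ μ.map Neg.neg) := by
        simp only [integral_const_mul, integral_conv hint]
    _ = ((kernelScale h * ∫ ξ, ‖charFun μ ξ‖ ^ 2 ∂frequencyLaw h : ℝ) : ℂ) := by
        rw [integral_charFun_comm]
        simp only [charFun_conv_map_neg, integral_complex_ofReal, Complex.ofReal_mul]

lemma integrable_sq_norm_charFun (μ ν : Measure ℝ) [IsProbabilityMeasure μ] [IsFiniteMeasure ν] :
    Integrable (fun ξ => ‖charFun μ ξ‖ ^ 2) ν :=
  .of_bound (stronglyMeasurable_charFun.norm.pow 2).aestronglyMeasurable 1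
    (ae_of_all _ fun ξ => by simpa using norm_charFun_le_one ξ)

lemma abs_informationPotential_sub_le (hh : 0 < h) (μ ν : Measure ℝ) [IsProbabilityMeasure μ]
    [IsProbabilityMeasure ν] :
    |informationPotential h μ - informationPotential h ν| ≤
      2 * kernelScale h * ∫ ξ, ‖charFun μ ξ - charFun ν ξ‖ ∂frequencyLaw h := by
  have hint (μ : Measure ℝ) [IsProbabilityMeasure μ] : Integrable (charFun μ) (frequencyLaw h) :=
    .of_bound stronglyMeasurable_charFun.aestronglyMeasurable 1 (ae_of_all _ norm_charFun_le_one)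
  have hint_sq (μ : Measure ℝ) [IsProbabilityMeasure μ] :=
    integrable_sq_norm_charFun μ (frequencyLaw h)
  have hsq (ξ : ℝ) : |‖charFun μ ξ‖ ^ 2 - ‖charFun ν ξ‖ ^ 2| ≤
      2 * ‖charFun μ ξ - charFun ν ξ‖ := by
    rw [sq_sub_sq, abs_mul, abs_of_nonneg (by positivity)]
    exact mul_le_mul (by linarith [norm_charFun_le_one (μ := μ) ξ, norm_charFun_le_one (μ := ν) ξ])
      (abs_norm_sub_norm_le _ _) (abs_nonneg _) two_pos.le
  rw [informationPotential_eq_integral_sq_norm_charFun,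
    informationPotential_eq_integral_sq_norm_charFun, ← mul_sub,
    ← integral_sub (hint_sq μ) (hint_sq ν), abs_mul, abs_of_pos (kernelScale_pos hh), mul_comm 2,
    mul_assoc, ← integral_const_mul]
  exact mul_le_mul_of_nonneg_left (abs_integral_le_integral_abs.trans
    (integral_mono ((hint_sq μ).sub (hint_sq ν)).abs (((hint μ).sub (hint ν)).norm.const_mul 2)
      hsq)) (kernelScale_pos hh).le

end InformationPotential

section EmpiricalLaw

variable {ι : Type*} [Fintype ι]

/-- The empirical law `n⁻¹ ∑ⱼ δ_{eⱼ}` of a family of reals. -/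
def empiricalLaw (e : ι → ℝ) : Measure ℝ := (Fintype.card ι : ℝ≥0∞)⁻¹ • ∑ j, Measure.dirac (e j)

instance [Nonempty ι] (e : ι → ℝ) : IsProbabilityMeasure (empiricalLaw e) where
  measure_univ := by
    simp [empiricalLaw, ENNReal.inv_mul_cancel]

lemma integral_empiricalLaw {E : Type*} [NormedAddCommGroup E] [NormedSpace ℝ E]
    [CompleteSpace E] (e : ι → ℝ) (g : ℝ → E) :
    ∫ t, g t ∂empiricalLaw e = (Fintype.card ι : ℝ)⁻¹ • ∑ j, g (e j) := by
  rw [empiricalLaw, integral_smul_measure, integral_finsetSum_measure fun j _ => ?_]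
  · simp
  · exact integrable_dirac (by simp [enorm_lt_top])

variable {X : Type*} {n : ℕ}

/-- The residuals `yⱼ - f(xⱼ)` of a sample. -/
def residuals (f : X → ℝ) (z : Fin n → X × ℝ) (j : Fin n) : ℝ := (z j).2 - f (z j).1

lemma empiricalEntropy_eq_neg_log_informationPotential (h : ℝ) (z : Fin n → X × ℝ)
    (f : X → ℝ) :
    empiricalEntropy h z f =
      -Real.log (informationPotential h (empiricalLaw (residuals f z))) := by
  simp only [empiricalEntropy, informationPotential, residuals, integral_empiricalLaw,
    smul_eq_mul, Fintype.card_fin, ← Finset.mul_sum]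
  congr 2
  ring

end EmpiricalLaw

section Population

variable {X : Type*} [MeasurableSpace X] {ρ : Measure (X × ℝ)} {f : X → ℝ}

lemma measurable_residual (hf : Measurable f) : Measurable fun z : X × ℝ => z.2 - f z.1 :=
  measurable_snd.sub (hf.comp measurable_fst)

lemma isProbabilityMeasure_errorLaw [IsProbabilityMeasure ρ] (hf : Measurable f) :
    IsProbabilityMeasure (errorLaw ρ f) :=
  Measure.isProbabilityMeasure_map (measurable_residual hf).aemeasurable

lemma informationError_eq_neg_informationPotential [IsFiniteMeasure ρ] (h : ℝ)
    (hf : Measurable f) : informationError ρ h f = -informationPotential h (errorLaw ρ f) := by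
  have hf' := measurable_residual hf
  have hK : Continuous fun q : ℝ × ℝ => gaussKernel h (q.1 - q.2) := by
    unfold gaussKernel; fun_prop
  rw [informationError, informationPotential, errorLaw, integral_map hf'.aemeasurable]
  · congr! 3 with z
    exact (integral_map hf'.aemeasurable
      (hK.comp (Continuous.prodMk_right _)).aestronglyMeasurable).symm
  · exact hK.measurable.stronglyMeasurable.integral_prod_right'.aestronglyMeasurable

lemma charFun_errorLaw (hf : Measurable f) (ξ : ℝ) :
    charFun (errorLaw ρ f) ξ = ∫ z, Complex.exp (ξ * (z.2 - f z.1 : ℝ) * Complex.I) ∂ρ := by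
  rw [charFun_apply_real, errorLaw,
    integral_map (measurable_residual hf).aemeasurable (by fun_prop)]

end Population

section CharacteristicDeviation

variable {X : Type*} [MeasurableSpace X] {ρ : Measure (X × ℝ)} {H : Set (X → ℝ)} {c s : ℝ}
  {ι : Type*} {u : ι → X → ℝ} {n : ℕ}

/-- The deviations at frequency `ξ` between the empirical and the true characteristic functions of
the errors of a family of predictors. -/
def charFunDeviation (ρ : Measure (X × ℝ)) (u : ι → X → ℝ) (ξ : ℝ) (z : Fin n → X × ℝ) (i : ι) :
    ℂ :=
  charFun (empiricalLaw (residuals (u i) z)) ξ - charFun (errorLaw ρ (u i)) ξ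

variable [IsProbabilityMeasure ρ]

lemma measurable_charFunDeviation (hum : ∀ i, Measurable (u i)) :
    Measurable fun q : ℝ × (Fin n → X × ℝ) => charFunDeviation ρ u q.1 q.2 := by
  refine measurable_pi_lambda _ fun i => ?_
  have := isProbabilityMeasure_errorLaw (ρ := ρ) (hum i)
  refine Measurable.sub ?_ (measurable_charFun.comp measurable_fst)
  simp only [charFun_apply_real, integral_empiricalLaw]
  refine (Finset.measurable_fun_sum _ fun j _ => ?_).const_smul _
  have hj : Measurable fun q : ℝ × (Fin n → X × ℝ) => residuals (u i) q.2 j :=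
    (measurable_residual (hum i)).comp ((measurable_pi_apply j).comp measurable_snd)
  fun_prop

variable [NeZero n] [Fintype ι]

lemma norm_charFunDeviation_le (hum : ∀ i, Measurable (u i)) (ξ : ℝ) (z : Fin n → X × ℝ) :
    ‖charFunDeviation ρ u ξ z‖ ≤ 2 := by
  refine (pi_norm_le_iff_of_nonneg two_pos.le).2 fun i => ?_
  have := isProbabilityMeasure_errorLaw (ρ := ρ) (hum i)
  exact (norm_sub_le_of_le (norm_charFun_le_one ξ) (norm_charFun_le_one ξ)).trans_eq
    one_add_one_eq_two

/-- The exponential `t ↦ e^{iξt}`, damped so as to be `1`-Lipschitz for every frequency. -/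
def dampedCharacter (ξ t : ℝ) : ℂ := Real.exp (-|ξ|) * Complex.exp (ξ * t * Complex.I)

lemma norm_dampedCharacter (ξ t : ℝ) : ‖dampedCharacter ξ t‖ = Real.exp (-|ξ|) := by
  rw [dampedCharacter, norm_mul, ← Complex.ofReal_mul, Complex.norm_exp_ofReal_mul_I, mul_one,
    Complex.norm_real, Real.norm_eq_abs, Real.abs_exp]

lemma norm_dampedCharacter_le_one (ξ t : ℝ) : ‖dampedCharacter ξ t‖ ≤ 1 := by
  rw [norm_dampedCharacter]
  exact Real.exp_le_one_iff.2 (neg_nonpos.2 (abs_nonneg ξ))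

lemma lipschitzWith_dampedCharacter (ξ : ℝ) : LipschitzWith 1 (dampedCharacter ξ) := by
  refine LipschitzWith.of_dist_le_mul fun t r => ?_
  have hexp : Real.exp (-|ξ|) * |ξ| ≤ 1 := by
    rw [Real.exp_neg, inv_mul_le_one₀ (Real.exp_pos _)]
    linarith [Real.add_one_le_exp |ξ|]
  have hfactor : dampedCharacter ξ t - dampedCharacter ξ r =
      dampedCharacter ξ r * (Complex.exp (Complex.I * (ξ * (t - r) : ℝ)) - 1) := by
    rw [dampedCharacter, dampedCharacter, mul_sub_one, mul_assoc _ (Complex.exp _),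
      ← Complex.exp_add]
    push_cast
    ring_nf
  calc dist (dampedCharacter ξ t) (dampedCharacter ξ r)
      ≤ Real.exp (-|ξ|) * |ξ * (t - r)| := by
        rw [dist_eq_norm, hfactor, norm_mul, norm_dampedCharacter]
        exact mul_le_mul_of_nonneg_left Real.norm_exp_I_mul_ofReal_sub_one_le
          (Real.exp_pos _).le
    _ ≤ 1 * dist t r := by
        rw [abs_mul, ← mul_assoc, Real.dist_eq]
        exact mul_le_mul_of_nonneg_right hexp (abs_nonneg _)

variable [Nonempty ι]

lemma hasUpperSubgaussianMGF_norm_charFunDeviation (hc : 0 ≤ c) (hs : 0 ≤ s) (hs2 : s < 2)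
    (hH : HasEmpiricalEntropyBound H c s) (hu : ∀ i, u i ∈ H) (hum : ∀ i, Measurable (u i))
    (ξ : ℝ) :
    HasUpperSubgaussianMGF (fun z => Real.exp (-|ξ|) * ‖charFunDeviation ρ u ξ z‖)
      (2 * chainingConst c s / √n) (Measure.pi fun _ : Fin n => ρ) := by
  have hn : (0 : ℝ) < n := Nat.cast_pos.2 (NeZero.pos n)
  have h := (hasUpperSubgaussianMGF_norm_sum_feature (ρ := ρ) (n := n) hc hs hs2 hH
    (norm_dampedCharacter_le_one ξ) (lipschitzWith_dampedCharacter ξ) hu hum).const_mul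
    (inv_nonneg.2 hn.le)
  have hscale : (n : ℝ)⁻¹ * (2 * √n * chainingConst c s) = 2 * chainingConst c s / √n := by
    rw [inv_mul_eq_div, div_eq_div_iff hn.ne' (Real.sqrt_pos.2 hn).ne']
    linear_combination (2 * chainingConst c s) * Real.mul_self_sqrt hn.le
  rw [hscale] at h
  convert h using 2 with z
  have hsmul : (fun i => ∑ j, dampedCharacter ξ ((z j).2 - u i (z j).1) -
      (n : ℂ) * ∫ q, dampedCharacter ξ (q.2 - u i q.1) ∂ρ) =
      ((n : ℝ) * Real.exp (-|ξ|)) • charFunDeviation ρ u ξ z := by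
    ext i
    simp only [dampedCharacter, charFunDeviation, residuals, integral_const_mul,
      ← Finset.mul_sum, charFun_errorLaw (hum i), charFun_apply_real, integral_empiricalLaw,
      Fintype.card_fin, Pi.smul_apply, Complex.real_smul]
    have hfactor (E S J : ℂ) : E * S - n * (E * J) = n * E * ((n : ℂ)⁻¹ * S - J) := by
      field [NeZero.ne (n : ℂ)]
    simpa only [Complex.ofReal_mul, Complex.ofReal_inv, Complex.ofReal_natCast] using
      hfactor _ _ _
  rw [hsmul, norm_smul, Real.norm_of_nonneg (by positivity)]
  field_simp

lemma integrable_exp_abs_frequencyLaw (h : ℝ) :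
    Integrable (fun ξ => Real.exp |ξ|) (frequencyLaw h) := by
  simpa using integrable_exp_mul_abs (X := id) (μ := frequencyLaw h) (t := 1)
    (integrable_exp_mul_gaussianReal _) (integrable_exp_mul_gaussianReal _)

lemma hasUpperSubgaussianMGF_integral_norm_charFunDeviation {γ : Measure ℝ}
    [IsProbabilityMeasure γ] (hγ : Integrable (fun ξ => Real.exp |ξ|) γ) (hc : 0 ≤ c)
    (hs : 0 ≤ s) (hs2 : s < 2) (hH : HasEmpiricalEntropyBound H c s) (hu : ∀ i, u i ∈ H)
    (hum : ∀ i, Measurable (u i)) :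
    HasUpperSubgaussianMGF (fun z => ∫ ξ, ‖charFunDeviation ρ u ξ z‖ ∂γ)
      ((∫ ξ, Real.exp |ξ| ∂γ) * (2 * chainingConst c s / √n))
      (Measure.pi fun _ : Fin n => ρ) := by
  have := isProbabilityMeasure_tilted hγ
  have hM : 0 < ∫ ξ, Real.exp |ξ| ∂γ := integral_exp_pos hγ
  have hmeas : Measurable (Function.uncurry fun (ξ : ℝ) (z : Fin n → X × ℝ) =>
      Real.exp (-|ξ|) * ‖charFunDeviation ρ u ξ z‖) :=
    (by fun_prop : Measurable fun q : ℝ × (Fin n → X × ℝ) => Real.exp (-|q.1|)).mul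
      (measurable_charFunDeviation hum).norm
  have hbound (ξ : ℝ) (z : Fin n → X × ℝ) :
      |Real.exp (-|ξ|) * ‖charFunDeviation ρ u ξ z‖| ≤ 1 * 2 := by
    rw [abs_mul, Real.abs_exp, abs_norm]
    exact mul_le_mul (Real.exp_le_one_iff.2 (neg_nonpos.2 (abs_nonneg ξ)))
      (norm_charFunDeviation_le hum ξ z) (norm_nonneg _) zero_le_one
  have h := (HasUpperSubgaussianMGF.integral_param (ν := γ.tilted fun ξ => |ξ|) hmeas hbound
    (hasUpperSubgaussianMGF_norm_charFunDeviation (ρ := ρ) hc hs hs2 hH hu hum)).const_mul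
    hM.le
  convert h using 2 with z
  rw [integral_tilted, ← integral_const_mul]
  congr! 2
  rw [smul_eq_mul, Real.exp_neg]
  field_simp

end CharacteristicDeviation

section UniformDeviation

lemma measure_biUnion_le_of_forall_finset {Ω ι : Type*} {mΩ : MeasurableSpace Ω} {P : Measure Ω}
    {U : ι → Set Ω} {b : ℝ≥0∞} (hU : ∀ F : Finset ι, P (⋃ i ∈ F, U i) ≤ b) {t : Set ι}
    (ht : t.Countable) : P (⋃ i ∈ t, U i) ≤ b := by
  have := ht.to_subtype
  rw [biUnion_eq_iUnion, iUnion_eq_iUnion_finset, Directed.measure_iUnion]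
  · refine iSup_le fun F => (measure_mono ?_).trans (hU (F.map (Function.Embedding.subtype _)))
    simp
  · exact Monotone.directed_le fun F G h => biUnion_subset_biUnion_left h

lemma exists_countable_range_inter_iUnion_subset {E F ι : Type*} [TopologicalSpace E]
    [TopologicalSpace F] [SecondCountableTopology F] {g : F → E} (hg : Continuous g)
    {U : ι → Set E} (hU : ∀ i, IsOpen (U i)) :
    ∃ t : Set ι, t.Countable ∧ range g ∩ ⋃ i, U i ⊆ ⋃ i ∈ t, U i := by
  obtain ⟨t, ht, heq⟩ :=
    TopologicalSpace.isOpen_iUnion_countable (fun i => g ⁻¹' U i) fun i => (hU i).preimage hg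
  refine ⟨t, ht, ?_⟩
  rintro - ⟨⟨y, rfl⟩, hy⟩
  rwa [← mem_preimage, preimage_iUnion, ← heq, ← preimage_iUnion₂, mem_preimage] at hy

/-- Uncountably many open events are reduced to finitely many by Lindelöf's theorem. -/
lemma measure_iUnion_le_of_forall_finset {E F ι : Type*} [TopologicalSpace E]
    [MeasurableSpace E] [TopologicalSpace F] [SecondCountableTopology F] {P : Measure E}
    {g : F → E} (hg : Continuous g) (hrange : ∀ᵐ z ∂P, z ∈ range g) {U : ι → Set E}
    (hU : ∀ i, IsOpen (U i)) {b : ℝ≥0∞} (hb : ∀ s : Finset ι, P (⋃ i ∈ s, U i) ≤ b) :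
    P (⋃ i, U i) ≤ b := by
  obtain ⟨t, ht, hsub⟩ := exists_countable_range_inter_iUnion_subset hg hU
  refine (measure_mono_ae ?_).trans (measure_biUnion_le_of_forall_finset hb ht)
  filter_upwards [hrange] with z hz hzU using hsub ⟨hz, hzU⟩

variable {X : Type*} {H : Set (X → ℝ)} {c s h : ℝ} {n : ℕ}

/-- The sub-Gaussian scale, up to the factor `n^{-1/2}`, of the uniform deviation of the
information potential over a class with entropy constants `c` and `s`. -/
def deviationScale (h c s : ℝ) : ℝ :=
  2 * kernelScale h * ((∫ ξ, Real.exp |ξ| ∂frequencyLaw h) * (2 * chainingConst c s))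

lemma measureReal_exists_informationPotential_deviation_le [MeasurableSpace X]
    {ρ : Measure (X × ℝ)} [IsProbabilityMeasure ρ] [NeZero n] (hc : 0 ≤ c)
    (hs : 0 ≤ s) (hs2 : s < 2) (hH : HasEmpiricalEntropyBound H c s) (hh : 0 < h)
    {ι : Type*} [Finite ι] {u : ι → X → ℝ} (hu : ∀ i, u i ∈ H) (hum : ∀ i, Measurable (u i))
    {t : ℝ} (ht : 0 ≤ t) :
    (Measure.pi fun _ : Fin n => ρ).real {z | ∃ i, t ≤
        |informationPotential h (empiricalLaw (residuals (u i) z)) -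
          informationPotential h (errorLaw ρ (u i))|} ≤
      2 * Real.exp (-n * t ^ 2 / (4 * deviationScale h c s ^ 2)) := by
  cases isEmpty_or_nonempty ι
  · simp only [IsEmpty.exists_iff, Set.ofPred_false, measureReal_empty]
    positivity
  have := Fintype.ofFinite ι
  have hn : (0 : ℝ) < n := Nat.cast_pos.2 (NeZero.pos n)
  have hA : 0 ≤ 2 * kernelScale h := mul_nonneg two_pos.le (kernelScale_pos hh).le
  have hdev := (hasUpperSubgaussianMGF_integral_norm_charFunDeviation (ρ := ρ) (n := n)
    (integrable_exp_abs_frequencyLaw h) hc hs hs2 hH hu hum).const_mul hA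
  have hle (z : Fin n → X × ℝ) (i : ι) :
      |informationPotential h (empiricalLaw (residuals (u i) z)) -
          informationPotential h (errorLaw ρ (u i))| ≤
        2 * kernelScale h * ∫ ξ, ‖charFunDeviation ρ u ξ z‖ ∂frequencyLaw h := by
    have := isProbabilityMeasure_errorLaw (ρ := ρ) (hum i)
    refine (abs_informationPotential_sub_le hh _ _).trans (mul_le_mul_of_nonneg_left ?_ hA)
    have hnorm : Integrable (fun ξ => ‖charFunDeviation ρ u ξ z‖) (frequencyLaw h) :=
      .of_bound ((measurable_charFunDeviation hum).comp
        measurable_prodMk_right).norm.aestronglyMeasurable 2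
        (ae_of_all _ fun ξ => (norm_norm _).trans_le (norm_charFunDeviation_le hum ξ z))
    exact integral_mono_of_nonneg (ae_of_all _ fun ξ => norm_nonneg _) hnorm
      (ae_of_all _ fun ξ => norm_le_pi_norm (charFunDeviation ρ u ξ z) i)
  refine (measureReal_mono ?_).trans ((hdev.measureReal_ge_le ht).trans_eq ?_)
  · rintro z ⟨i, hi⟩
    exact hi.trans (hle z i)
  have hscale : 2 * kernelScale h * ((∫ ξ, Real.exp |ξ| ∂frequencyLaw h) *
      (2 * chainingConst c s / √n)) = deviationScale h c s / √n := by
    rw [deviationScale]; ring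
  rw [hscale, div_pow, Real.sq_sqrt hn.le, mul_div_assoc', div_div_eq_mul_div]
  ring_nf

lemma continuous_informationPotential_empiricalLaw [TopologicalSpace X] {f : X → ℝ}
    (hf : Continuous f) (h : ℝ) :
    Continuous fun z : Fin n → X × ℝ =>
      informationPotential h (empiricalLaw (residuals f z)) := by
  simp only [informationPotential, integral_empiricalLaw, gaussKernel, residuals]
  fun_prop

/-- The failure event is a union of open sets over a possibly uncountable class, so its
probability is an outer one in general. -/
lemma measure_exists_informationPotential_deviation_le [TopologicalSpace X] [MeasurableSpace X]
    [OpensMeasurableSpace X] {ρ : Measure (X × ℝ)} [IsProbabilityMeasure ρ] {S : Set X}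
    [SecondCountableTopology S] (hS : ∀ᵐ x ∂ρ.fst, x ∈ S) (hcont : ∀ f ∈ H, Continuous f)
    [NeZero n] (hc : 0 ≤ c) (hs : 0 ≤ s) (hs2 : s < 2) (hH : HasEmpiricalEntropyBound H c s)
    (hh : 0 < h) {t : ℝ} (ht : 0 ≤ t) :
    (Measure.pi fun _ : Fin n => ρ) {z | ∃ f ∈ H, t <
        |informationPotential h (empiricalLaw (residuals f z)) -
          informationPotential h (errorLaw ρ f)|} ≤
      ENNReal.ofReal (2 * Real.exp (-n * t ^ 2 / (4 * deviationScale h c s ^ 2))) := by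
  let U (f : H) : Set (Fin n → X × ℝ) := {z | t <
    |informationPotential h (empiricalLaw (residuals f.1 z)) -
      informationPotential h (errorLaw ρ f.1)|}
  have hU (f : H) : IsOpen (U f) := isOpen_lt continuous_const
    ((continuous_informationPotential_empiricalLaw (hcont f f.2) h).sub continuous_const).abs
  let g (y : Fin n → S × ℝ) (j : Fin n) : X × ℝ := ((y j).1, (y j).2)
  have hrange : ∀ᵐ z ∂(Measure.pi fun _ : Fin n => ρ), z ∈ range g := by
    have hsample : ∀ᵐ z ∂(Measure.pi fun _ : Fin n => ρ), ∀ j, (z j).1 ∈ S :=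
      ae_all_iff.2 fun j => (measurePreserving_eval (fun _ => ρ) j).quasiMeasurePreserving.ae
        (ae_of_ae_map measurable_fst.aemeasurable hS)
    filter_upwards [hsample] with z hz
    exact ⟨fun j => (⟨(z j).1, hz j⟩, (z j).2), rfl⟩
  have hfinite (F : Finset H) : (Measure.pi fun _ : Fin n => ρ) (⋃ f ∈ F, U f) ≤
      ENNReal.ofReal (2 * Real.exp (-n * t ^ 2 / (4 * deviationScale h c s ^ 2))) := by
    rw [← ofReal_measureReal (measure_ne_top _ _)]
    refine ENNReal.ofReal_le_ofReal ((measureReal_mono fun z hz => ?_).trans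
      (measureReal_exists_informationPotential_deviation_le hc hs hs2 hH hh
        (u := fun f : F => f.1.1) (fun f => f.1.2) (fun f => (hcont _ f.1.2).measurable) ht))
    obtain ⟨f, hf, hz⟩ := mem_iUnion₂.1 hz
    exact ⟨⟨f, hf⟩, hz.le⟩
  refine (measure_mono ?_).trans
    (measure_iUnion_le_of_forall_finset (g := g) (by fun_prop) hrange hU hfinite)
  rintro z ⟨f, hf, hz⟩
  exact mem_iUnion.2 ⟨⟨f, hf⟩, hz⟩

end UniformDeviation

section OscillatoryIntegral

variable {α : Type*} [MeasurableSpace α] {μ : Measure α} {φ θ : α → ℝ}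

lemma integrable_mul_exp_mul_I (hφ : Integrable φ μ) (hθ : AEMeasurable θ μ) :
    Integrable (fun x => φ x * Complex.exp (θ x * Complex.I)) μ := by
  refine hφ.ofReal.mul_bdd (c := 1) (by fun_prop) (ae_of_all _ fun x => ?_)
  rw [Complex.norm_exp_ofReal_mul_I]

lemma norm_integral_mul_exp_mul_I_le (hφ : 0 ≤ φ) :
    ‖∫ x, φ x * Complex.exp (θ x * Complex.I) ∂μ‖ ≤ ∫ x, φ x ∂μ := by
  refine (norm_integral_le_integral_norm _).trans_eq (integral_congr_ae (ae_of_all _ fun x => ?_))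
  simp only [norm_mul, Complex.norm_real, Real.norm_of_nonneg (hφ x),
    Complex.norm_exp_ofReal_mul_I, mul_one]

lemma sq_norm_integral_mul_exp_mul_I [SFinite μ] (hφ : Integrable φ μ) (hθ : AEMeasurable θ μ) :
    ‖∫ x, φ x * Complex.exp (θ x * Complex.I) ∂μ‖ ^ 2 =
      ∫ q : α × α, φ q.1 * φ q.2 * Real.cos (θ q.1 - θ q.2) ∂μ.prod μ := by
  have hint := integrable_mul_exp_mul_I hφ hθ
  have hconj : Integrable (fun x => starRingEnd ℂ (φ x * Complex.exp (θ x * Complex.I))) μ :=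
    Complex.conjLIE.integrable_comp_iff.2 hint
  have hre (q : α × α) : φ q.1 * φ q.2 * Real.cos (θ q.1 - θ q.2) =
      RCLike.re (φ q.1 * Complex.exp (θ q.1 * Complex.I) *
        starRingEnd ℂ (φ q.2 * Complex.exp (θ q.2 * Complex.I))) := by
    rw [RCLike.re_eq_complex_re, map_mul, Complex.conj_ofReal, ← Complex.exp_conj,
      mul_mul_mul_comm, ← Complex.exp_add, map_mul, Complex.conj_ofReal, Complex.conj_I, mul_neg,
      ← sub_eq_add_neg, ← sub_mul, ← Complex.ofReal_sub, ← Complex.ofReal_mul,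
      Complex.re_ofReal_mul, Complex.exp_ofReal_mul_I_re]
  simp only [hre]
  rw [integral_re (hint.mul_prod hconj),
    integral_prod_mul (fun x => φ x * Complex.exp (θ x * Complex.I))
      (fun x => starRingEnd ℂ (φ x * Complex.exp (θ x * Complex.I))),
    integral_conj, Complex.mul_conj']
  norm_cast

lemma sq_integral_sub_sq_norm_integral_mul_exp_mul_I [SFinite μ] (hφ : Integrable φ μ)
    (hθ : AEMeasurable θ μ) :
    (∫ x, φ x ∂μ) ^ 2 - ‖∫ x, φ x * Complex.exp (θ x * Complex.I) ∂μ‖ ^ 2 =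
      ∫ q : α × α, φ q.1 * φ q.2 * (1 - Real.cos (θ q.1 - θ q.2)) ∂μ.prod μ := by
  have hprod : Integrable (fun q : α × α => φ q.1 * φ q.2) (μ.prod μ) := hφ.mul_prod hφ
  have hcos : Integrable (fun q : α × α => φ q.1 * φ q.2 * Real.cos (θ q.1 - θ q.2))
      (μ.prod μ) :=
    hprod.mul_bdd (c := 1) (by fun_prop) (ae_of_all _ fun q => Real.abs_cos_le_one _)
  simp only [mul_one_sub]
  rw [sq_norm_integral_mul_exp_mul_I hφ hθ, integral_sub hprod hcos, integral_prod_mul, sq]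

lemma integral_prod_sq_sub [IsProbabilityMeasure μ] (hθ : MemLp θ 2 μ) :
    ∫ q : α × α, (θ q.1 - θ q.2) ^ 2 ∂μ.prod μ = 2 * Var[θ; μ] := by
  have hint := hθ.integrable one_le_two
  have hmean : ∫ q : α × α, (θ q.1 + (-θ) q.2) ∂μ.prod μ = 0 := by
    rw [integral_add (hint.comp_fst μ) (hint.neg.comp_snd μ), integral_fun_fst, integral_fun_snd]
    simp [integral_neg]
  have hvar := variance_add_prod hθ hθ.neg
  rw [variance_neg, variance_of_integral_eq_zero (by fun_prop) hmean] at hvar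
  simpa only [Pi.neg_apply, ← sub_eq_add_neg, two_mul] using hvar

/-- The phase differences lie in `[-π, π]`, where `1 - cos u ≥ 2 u ^ 2 / π ^ 2`. -/
lemma mul_variance_le_sq_integral_sub_sq_norm [IsProbabilityMeasure μ] {C : ℝ} (hC : 0 ≤ C)
    (hφ : Integrable φ μ) (hCφ : ∀ x, C ≤ φ x) (hθm : AEMeasurable θ μ)
    (hθ : ∀ x, |θ x| ≤ Real.pi / 2) :
    C ^ 2 * (4 / Real.pi ^ 2) * Var[θ; μ] ≤
      (∫ x, φ x ∂μ) ^ 2 - ‖∫ x, φ x * Complex.exp (θ x * Complex.I) ∂μ‖ ^ 2 := by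
  have hθ2 : MemLp θ 2 μ := .of_bound hθm.aestronglyMeasurable _ (ae_of_all _ hθ)
  have hcos (q : α × α) : 2 / Real.pi ^ 2 * (θ q.1 - θ q.2) ^ 2 ≤
      1 - Real.cos (θ q.1 - θ q.2) := by
    have := Real.cos_le_one_sub_mul_cos_sq (x := θ q.1 - θ q.2)
      ((abs_sub _ _).trans (by linarith [hθ q.1, hθ q.2]))
    linarith
  rw [sq_integral_sub_sq_norm_integral_mul_exp_mul_I hφ hθm]
  calc C ^ 2 * (4 / Real.pi ^ 2) * Var[θ; μ]
      = ∫ q : α × α, C * C * (2 / Real.pi ^ 2 * (θ q.1 - θ q.2) ^ 2) ∂μ.prod μ := by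
        rw [integral_const_mul, integral_const_mul, integral_prod_sq_sub hθ2]
        ring
    _ ≤ ∫ q : α × α, φ q.1 * φ q.2 * (1 - Real.cos (θ q.1 - θ q.2)) ∂μ.prod μ := by
        refine integral_mono ?_ ?_ fun q => ?_
        · exact (((hθ2.comp_fst μ).sub (hθ2.comp_snd μ)).integrable_sq.const_mul _).const_mul _
        · refine (hφ.mul_prod hφ).mul_bdd (c := 2) (by fun_prop) (ae_of_all _ fun q => ?_)
          rw [Real.norm_eq_abs, abs_le]
          constructor <;>
            linarith [Real.neg_one_le_cos (θ q.1 - θ q.2), Real.cos_le_one (θ q.1 - θ q.2)]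
        · have hφ0 (x : α) : 0 ≤ φ x := hC.trans (hCφ x)
          exact mul_le_mul (mul_le_mul (hCφ _) (hCφ _) hC (hφ0 _)) (hcos q) (by positivity)
            (mul_nonneg (hφ0 _) (hφ0 _))

end OscillatoryIntegral

lemma setIntegral_sq_frequencyLaw_pos {h a : ℝ} (hh : 0 < h) (ha : 0 < a) :
    0 < ∫ ξ in Icc (-a) a, ξ ^ 2 ∂frequencyLaw h := by
  have hint : IntegrableOn (fun ξ : ℝ => ξ ^ 2) (Icc (-a) a) (frequencyLaw h) :=
    (continuous_pow 2).continuousOn.integrableOn_Icc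
  refine (setIntegral_pos_iff_support_of_nonneg_ae (ae_of_all _ fun ξ => sq_nonneg ξ) hint).2 ?_
  have hsub : Ioo 0 a ⊆ (Function.support fun ξ : ℝ => ξ ^ 2) ∩ Icc (-a) a := fun ξ hξ =>
    ⟨pow_ne_zero 2 hξ.1.ne', by linarith [hξ.1], hξ.2.le⟩
  have hvar : Real.toNNReal (1 / h ^ 2) ≠ 0 := (Real.toNNReal_pos.2 (by positivity)).ne'
  have hvol : volume (Ioo 0 a) ≠ 0 := by simpa using ha
  exact (pos_iff_ne_zero.2 fun h0 => hvol (gaussianReal_absolutelyContinuous' 0 hvar h0)).trans_le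
    (measure_mono hsub)

section PopulationComparison

variable {X : Type*} [MeasurableSpace X] {ρ : Measure (X × ℝ)} {fstar f : X → ℝ} {p : X → ℝ → ℝ}

lemma IsRegressionModel.measurable_ofReal_density (hm : IsRegressionModel ρ fstar p) :
    Measurable fun q : X × ℝ => ENNReal.ofReal (p q.1 q.2) :=
  hm.measurable_density.ennreal_ofReal

variable [IsProbabilityMeasure ρ]

section Noise

variable {E : Type*} [NormedAddCommGroup E] [NormedSpace ℝ E] {F : X × ℝ → E}

lemma IsRegressionModel.integrable_density_smul (hm : IsRegressionModel ρ fstar p)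
    (hF : AEStronglyMeasurable F (ρ.map fun z => (z.1, z.2 - fstar z.1))) {B : ℝ}
    (hB : ∀ q, ‖F q‖ ≤ B) :
    Integrable (fun q => p q.1 q.2 • F q) (ρ.fst.prod volume) := by
  have := Measure.isProbabilityMeasure_map (μ := ρ)
    (measurable_fst.prodMk (measurable_residual hm.measurable_fstar)).aemeasurable
  have hint := Integrable.of_bound hF B (ae_of_all _ hB)
  rw [hm.law_noise, integrable_withDensity_iff_integrable_smul' hm.measurable_ofReal_density
    (ae_of_all _ fun _ => ENNReal.ofReal_lt_top)] at hint
  simpa only [ENNReal.toReal_ofReal (hm.density_nonneg _ _)] using hint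

lemma IsRegressionModel.integral_comp_noise (hm : IsRegressionModel ρ fstar p)
    (hF : AEStronglyMeasurable F (ρ.map fun z => (z.1, z.2 - fstar z.1))) {B : ℝ}
    (hB : ∀ q, ‖F q‖ ≤ B) :
    ∫ z, F (z.1, z.2 - fstar z.1) ∂ρ = ∫ x, (∫ t, p x t • F (x, t)) ∂ρ.fst := by
  have hint := hm.integrable_density_smul hF hB
  rw [← integral_map
    (measurable_fst.prodMk (measurable_residual hm.measurable_fstar)).aemeasurable hF,
    hm.law_noise, integral_withDensity_eq_integral_toReal_smul
      hm.measurable_ofReal_density (ae_of_all _ fun _ => ENNReal.ofReal_lt_top)]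
  simp only [ENNReal.toReal_ofReal (hm.density_nonneg _ _)]
  exact integral_prod _ hint

end Noise

/-- The characteristic function at `ξ` of the noise given `X = x`, as a function of `x`.  Only its
real part is kept, since it is used when the Fourier transform of the noise is real; the sign comes
from `fourierHat` being normalized with `e^{-itξ}`. -/
def noiseCharFun (p : X → ℝ → ℝ) (ξ : ℝ) (x : X) : ℝ := (fourierHat (p x) (-ξ)).re

lemma fourierHat_neg (g : ℝ → ℝ) (ξ : ℝ) :
    fourierHat g (-ξ) = ∫ t, g t • Complex.exp (ξ * t * Complex.I) := by
  simp only [fourierHat, Complex.real_smul]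
  congr! 3 with t
  push_cast
  ring_nf

lemma norm_exp_ofReal_mul_ofReal_mul_I (ξ t : ℝ) : ‖Complex.exp (ξ * t * Complex.I)‖ = 1 := by
  rw [← Complex.ofReal_mul, Complex.norm_exp_ofReal_mul_I]

lemma IsRegressionModel.integrable_noiseCharFun (hm : IsRegressionModel ρ fstar p) (ξ : ℝ) :
    Integrable (noiseCharFun p ξ) ρ.fst := by
  have hint := hm.integrable_density_smul
    (F := fun q => Complex.exp (ξ * q.2 * Complex.I)) (by fun_prop)
    fun q => (norm_exp_ofReal_mul_ofReal_mul_I ξ q.2).le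
  have heq : noiseCharFun p ξ =
      fun x => RCLike.re (∫ t, p x t • Complex.exp (ξ * t * Complex.I)) :=
    funext fun x => congrArg Complex.re (fourierHat_neg (p x) ξ)
  exact heq ▸ hint.integral_prod_left.re

lemma IsRegressionModel.charFun_errorLaw_eq (hm : IsRegressionModel ρ fstar p)
    (hreal : ∀ x ξ, (fourierHat (p x) ξ).im = 0) (hf : Measurable f) (ξ : ℝ) :
    charFun (errorLaw ρ f) ξ = ∫ x, noiseCharFun p ξ x *
      Complex.exp ((ξ * (fstar x - f x) : ℝ) * Complex.I) ∂ρ.fst := by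
  have hnoise (x : X) : (noiseCharFun p ξ x : ℂ) =
      ∫ t, p x t • Complex.exp (ξ * t * Complex.I) := by
    rw [← fourierHat_neg]
    exact Complex.ext rfl (by simp [hreal])
  have hfstar := hm.measurable_fstar
  have hmeas : Measurable fun q : X × ℝ =>
      Complex.exp (ξ * (q.2 + (fstar q.1 - f q.1) : ℝ) * Complex.I) := by
    fun_prop
  have hcomp := hm.integral_comp_noise hmeas.aestronglyMeasurable
    fun q => (norm_exp_ofReal_mul_ofReal_mul_I ξ _).le
  simp only [sub_add_sub_cancel] at hcomp
  rw [charFun_errorLaw hf, hcomp]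
  congr! 2 with x
  rw [hnoise, ← integral_mul_const]
  congr! 2
  rw [smul_mul_assoc, ← Complex.exp_add]
  push_cast
  ring_nf

lemma informationError_sub_eq {g : X → ℝ} {h : ℝ} (hf : Measurable f) (hg : Measurable g) :
    informationError ρ h f - informationError ρ h g = kernelScale h *
      ∫ ξ, (‖charFun (errorLaw ρ g) ξ‖ ^ 2 - ‖charFun (errorLaw ρ f) ξ‖ ^ 2) ∂frequencyLaw h := by
  have := isProbabilityMeasure_errorLaw (ρ := ρ) hf
  have := isProbabilityMeasure_errorLaw (ρ := ρ) hg
  rw [informationError_eq_neg_informationPotential h hf,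
    informationError_eq_neg_informationPotential h hg, neg_sub_neg,
    informationPotential_eq_integral_sq_norm_charFun,
    informationPotential_eq_integral_sq_norm_charFun, ← mul_sub,
    integral_sub (integrable_sq_norm_charFun _ _) (integrable_sq_norm_charFun _ _)]

variable (hm : IsRegressionModel ρ fstar p)
  (hreal : ∀ x ξ, (fourierHat (p x) ξ).im = 0) (hnonneg : ∀ x ξ, 0 ≤ (fourierHat (p x) ξ).re)

include hm hreal hnonneg

lemma norm_charFun_errorLaw_le (hf : Measurable f) (ξ : ℝ) :
    ‖charFun (errorLaw ρ f) ξ‖ ≤ ∫ x, noiseCharFun p ξ x ∂ρ.fst := by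
  rw [hm.charFun_errorLaw_eq hreal hf]
  exact norm_integral_mul_exp_mul_I_le fun x => hnonneg x (-ξ)

lemma norm_charFun_errorLaw_add_const (b ξ : ℝ) :
    ‖charFun (errorLaw ρ fun x => fstar x + b) ξ‖ = ∫ x, noiseCharFun p ξ x ∂ρ.fst := by
  rw [hm.charFun_errorLaw_eq hreal (hm.measurable_fstar.add_const b)]
  simp only [sub_add_cancel_left]
  rw [integral_mul_const, norm_mul, Complex.norm_exp_ofReal_mul_I, mul_one,
    integral_complex_ofReal, Complex.norm_real, Real.norm_of_nonneg]
  exact integral_nonneg fun x => hnonneg x (-ξ)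

lemma sq_norm_charFun_errorLaw_le (hf : Measurable f) (b ξ : ℝ) :
    ‖charFun (errorLaw ρ f) ξ‖ ^ 2 ≤ ‖charFun (errorLaw ρ fun x => fstar x + b) ξ‖ ^ 2 := by
  rw [norm_charFun_errorLaw_add_const hm hreal hnonneg]
  exact pow_le_pow_left₀ (norm_nonneg _) (norm_charFun_errorLaw_le hm hreal hnonneg hf ξ) 2

lemma isInformationErrorMinimizer_add_const {h : ℝ} (hh : 0 < h) (b : ℝ) :
    IsInformationErrorMinimizer ρ h fun x => fstar x + b := by
  have hb := hm.measurable_fstar.add_const b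
  refine ⟨hb, fun g hg => sub_nonneg.1 ?_⟩
  rw [informationError_sub_eq hg hb]
  exact mul_nonneg (kernelScale_pos hh).le (integral_nonneg fun ξ =>
    sub_nonneg.2 (sq_norm_charFun_errorLaw_le hm hreal hnonneg hg b ξ))

lemma mul_adjustedSqError_le_sq_norm_charFun_sub (hf : Measurable f) {ξ C : ℝ} (hC : 0 ≤ C)
    (hlow : ∀ x, C ≤ noiseCharFun p ξ x) (hfξ : ∀ x, |ξ * (fstar x - f x)| ≤ Real.pi / 2) :
    C ^ 2 * (4 / Real.pi ^ 2) * (ξ ^ 2 * adjustedSqError ρ fstar f) ≤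
      ‖charFun (errorLaw ρ fstar) ξ‖ ^ 2 - ‖charFun (errorLaw ρ f) ξ‖ ^ 2 := by
  have hdiff : Measurable fun x => fstar x - f x := hm.measurable_fstar.sub hf
  have hstar := norm_charFun_errorLaw_add_const hm hreal hnonneg 0 ξ
  simp only [add_zero] at hstar
  have hvar : adjustedSqError ρ fstar f = Var[fun x => fstar x - f x; ρ.fst] := by
    rw [variance_eq_integral hdiff.aemeasurable, adjustedSqError]
    congr! 2 with x
    rw [adjustment]
    ring
  rw [hvar, ← variance_const_mul, hstar, hm.charFun_errorLaw_eq hreal hf]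
  exact mul_variance_le_sq_integral_sub_sq_norm hC (hm.integrable_noiseCharFun ξ) hlow
    (hdiff.const_mul ξ).aemeasurable hfξ

lemma mul_adjustedSqError_le_informationError_sub (hf : Measurable f) {h a C : ℝ} (hh : 0 < h)
    (hC : 0 ≤ C) (hlow : ∀ x, ∀ ξ ∈ Icc (-a) a, C ≤ noiseCharFun p ξ x)
    (hfa : ∀ x, a * |fstar x - f x| ≤ Real.pi / 2) :
    kernelScale h * (C ^ 2 * (4 / Real.pi ^ 2) * ∫ ξ in Icc (-a) a, ξ ^ 2 ∂frequencyLaw h) *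
        adjustedSqError ρ fstar f ≤
      informationError ρ h f - informationError ρ h fstar := by
  have := isProbabilityMeasure_errorLaw (ρ := ρ) hf
  have := isProbabilityMeasure_errorLaw (ρ := ρ) hm.measurable_fstar
  have hpointwise (ξ : ℝ) : C ^ 2 * (4 / Real.pi ^ 2) * adjustedSqError ρ fstar f *
      (Icc (-a) a).indicator (fun ξ => ξ ^ 2) ξ ≤
        ‖charFun (errorLaw ρ fstar) ξ‖ ^ 2 - ‖charFun (errorLaw ρ f) ξ‖ ^ 2 := by
    by_cases hξ : ξ ∈ Icc (-a) a
    · have hfξ (x : X) : |ξ * (fstar x - f x)| ≤ Real.pi / 2 := by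
        rw [abs_mul]
        exact (mul_le_mul_of_nonneg_right (abs_le.2 hξ) (abs_nonneg _)).trans (hfa x)
      rw [indicator_of_mem hξ, mul_assoc _ (adjustedSqError _ _ _), mul_comm _ (ξ ^ 2)]
      exact mul_adjustedSqError_le_sq_norm_charFun_sub hm hreal hnonneg hf hC
        (fun x => hlow x ξ hξ) hfξ
    · rw [indicator_of_notMem hξ, mul_zero, sub_nonneg]
      simpa only [add_zero] using sq_norm_charFun_errorLaw_le hm hreal hnonneg hf 0 ξ
  have hfstar_sq := integrable_sq_norm_charFun (errorLaw ρ fstar) (frequencyLaw h)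
  have hf_sq := integrable_sq_norm_charFun (errorLaw ρ f) (frequencyLaw h)
  have hind : Integrable ((Icc (-a) a).indicator fun ξ => ξ ^ 2) (frequencyLaw h) :=
    (continuous_pow 2).continuousOn.integrableOn_Icc.integrable_indicator measurableSet_Icc
  rw [informationError_sub_eq hf hm.measurable_fstar, mul_assoc, mul_right_comm _ (∫ _ in _, _ ∂_),
    ← integral_indicator measurableSet_Icc, ← integral_const_mul]
  exact mul_le_mul_of_nonneg_left (integral_mono (hind.const_mul _) (hfstar_sq.sub hf_sq)
    hpointwise) (kernelScale_pos hh).le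

lemma exists_mul_adjustedSqError_le_informationError_sub
    (hlow : ∃ c₀ C₀ : ℝ, 0 < c₀ ∧ 0 < C₀ ∧
      ∀ x, ∀ ξ ∈ Icc (-c₀) c₀, C₀ ≤ (fourierHat (p x) ξ).re)
    {h : ℝ} (hh : 0 < h) (M : ℝ) :
    ∃ K : ℝ, 0 < K ∧ ∀ f : X → ℝ, Measurable f → (∀ x, |fstar x - f x| ≤ M) →
      K * adjustedSqError ρ fstar f ≤ informationError ρ h f - informationError ρ h fstar := by
  obtain ⟨c₀, C₀, hc₀, hC₀, hlow⟩ := hlow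
  have hM : 0 < max M 1 := one_pos.trans_le (le_max_right _ _)
  obtain ⟨a, ha, hac, haM⟩ : ∃ a > 0, a ≤ c₀ ∧ a * max M 1 ≤ Real.pi / 2 :=
    ⟨min c₀ (Real.pi / 2 / max M 1), lt_min hc₀ (by positivity), min_le_left _ _,
      (le_div_iff₀ hM).1 (min_le_right _ _)⟩
  have hsecond := setIntegral_sq_frequencyLaw_pos hh ha
  refine ⟨kernelScale h * (C₀ ^ 2 * (4 / Real.pi ^ 2) * ∫ ξ in Icc (-a) a, ξ ^ 2 ∂frequencyLaw h),
    mul_pos (kernelScale_pos hh) (by positivity), fun f hf hfM => ?_⟩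
  refine mul_adjustedSqError_le_informationError_sub hm hreal hnonneg hf hh hC₀.le
    (fun x ξ hξ => hlow x _ ⟨by linarith [hξ.2], by linarith [hξ.1]⟩) fun x => ?_
  exact (mul_le_mul_of_nonneg_left ((hfM x).trans (le_max_left _ _)) ha.le).trans haM

end PopulationComparison

section Rate

lemma deviationScale_pos {h c s : ℝ} (hh : 0 < h) (hc : 0 ≤ c) (hs : s < 2) :
    0 < deviationScale h c s := by
  have hexp := integral_exp_pos (integrable_exp_abs_frequencyLaw h)
  have hchain := chainingConst_pos hc hs
  have hscale := kernelScale_pos hh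
  unfold deviationScale
  positivity

lemma informationPotential_empiricalLaw_pos {ι : Type*} [Fintype ι] [Nonempty ι] {h : ℝ}
    (hh : 0 < h) (e : ι → ℝ) : 0 < informationPotential h (empiricalLaw e) := by
  simp only [informationPotential, integral_empiricalLaw, gaussKernel]
  positivity

variable {X : Type*} {H : Set (X → ℝ)} {n : ℕ} {h : ℝ}

lemma IsEmpiricalMinimizer.informationPotential_le [NeZero n] (hh : 0 < h)
    {z : Fin n → X × ℝ} {f g : X → ℝ} (hf : IsEmpiricalMinimizer H h z f) (hg : g ∈ H) :
    informationPotential h (empiricalLaw (residuals g z)) ≤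
      informationPotential h (empiricalLaw (residuals f z)) := by
  have hle := hf.2 g hg
  rwa [empiricalEntropy_eq_neg_log_informationPotential,
    empiricalEntropy_eq_neg_log_informationPotential, neg_le_neg_iff,
    Real.log_le_log_iff (informationPotential_empiricalLaw_pos hh _)
      (informationPotential_empiricalLaw_pos hh _)] at hle

lemma two_mul_exp_neg_sq_div_eq [NeZero n] {κ δ : ℝ} (hκ : 0 < κ) (hδ0 : 0 < δ) (hδ : δ ≤ 2) :
    2 * Real.exp (-n * (2 * κ * √(Real.log (2 / δ)) * (n : ℝ) ^ (-(1 / 2) : ℝ)) ^ 2 /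
      (4 * κ ^ 2)) = δ := by
  have hn : (0 : ℝ) < n := Nat.cast_pos.2 (NeZero.pos n)
  have hlog : 0 ≤ Real.log (2 / δ) := Real.log_nonneg ((one_le_div hδ0).2 hδ)
  have hpow : ((n : ℝ) ^ (-(1 / 2) : ℝ)) ^ 2 = (n : ℝ)⁻¹ := by
    rw [← Real.rpow_mul_natCast hn.le, ← Real.rpow_neg_one]
    norm_num
  have hexponent : -n * (2 * κ * √(Real.log (2 / δ)) * (n : ℝ) ^ (-(1 / 2) : ℝ)) ^ 2 /
      (4 * κ ^ 2) = -Real.log (2 / δ) := by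
    rw [mul_pow, mul_pow, Real.sq_sqrt hlog, hpow]
    field_simp
    ring
  rw [hexponent, Real.exp_neg, Real.exp_log (by positivity), inv_div]
  ring

variable [MeasurableSpace X] {ρ : Measure (X × ℝ)} [IsProbabilityMeasure ρ]

lemma IsEmpiricalMinimizer.informationError_sub_le [NeZero n] (hh : 0 < h)
    {z : Fin n → X × ℝ} {f g : X → ℝ} (hf : IsEmpiricalMinimizer H h z f) (hg : g ∈ H)
    (hmeas : ∀ f ∈ H, Measurable f) {t : ℝ}
    (ht : ∀ f ∈ H, |informationPotential h (empiricalLaw (residuals f z)) -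
      informationPotential h (errorLaw ρ f)| ≤ t) :
    informationError ρ h f - informationError ρ h g ≤ 2 * t := by
  rw [informationError_eq_neg_informationPotential h (hmeas f hf.1),
    informationError_eq_neg_informationPotential h (hmeas g hg)]
  linarith [hf.informationPotential_le hh hg, (abs_le.1 (ht f hf.1)).2, (abs_le.1 (ht g hg)).1]

lemma exists_rate [TopologicalSpace X] [OpensMeasurableSpace X] {S : Set X}
    [SecondCountableTopology S] (hS : ∀ᵐ x ∂ρ.fst, x ∈ S) {fstar : X → ℝ}
    (hcont : ∀ f ∈ H, Continuous f) (hfstar : fstar ∈ H) {c s : ℝ} (hc : 0 ≤ c)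
    (hs : 0 ≤ s) (hs2 : s < 2) (hH : HasEmpiricalEntropyBound H c s) (hh : 0 < h) {K : ℝ}
    (hK : 0 < K) (hexcess : ∀ f ∈ H, K * adjustedSqError ρ fstar f ≤
      informationError ρ h f - informationError ρ h fstar) :
    ∃ C : ℝ, 0 < C ∧ ∀ fz : (n : ℕ) → (Fin n → X × ℝ) → X → ℝ, IsMEEAlgorithm ρ H h fz →
      ∀ n : ℕ, 1 ≤ n → ∀ δ : ℝ, 0 < δ → δ < 1 →
        (Measure.pi fun _ : Fin n => ρ)
          {z | C * √(Real.log (2 / δ)) * (n : ℝ) ^ (-(1 / 2) : ℝ) <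
            adjustedSqError ρ fstar (fz n z)} ≤ ENNReal.ofReal δ := by
  have hκ := deviationScale_pos hh hc hs2
  refine ⟨4 * deviationScale h c s / K, by positivity, fun fz hfz n hn δ hδ0 hδ1 => ?_⟩
  have : NeZero n := ⟨Nat.one_le_iff_ne_zero.1 hn⟩
  set t := 2 * deviationScale h c s * √(Real.log (2 / δ)) * (n : ℝ) ^ (-(1 / 2) : ℝ) with ht
  have hsub : {z | 4 * deviationScale h c s / K * √(Real.log (2 / δ)) *
      (n : ℝ) ^ (-(1 / 2) : ℝ) < adjustedSqError ρ fstar (fz n z)}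
      ≤ᵐ[Measure.pi fun _ : Fin n => ρ]
      {z | ∃ f ∈ H, t < |informationPotential h (empiricalLaw (residuals f z)) -
        informationPotential h (errorLaw ρ f)|} := by
    filter_upwards [hfz n hn] with z hz
    change _ < _ → ∃ f ∈ H, _
    contrapose!
    intro hdev
    have hle := (hexcess _ hz.1).trans
      (hz.informationError_sub_le hh hfstar (fun f hf => (hcont f hf).measurable) hdev)
    refine ((le_div_iff₀' hK).2 hle).trans_eq ?_
    rw [ht]
    ring
  refine (measure_mono_ae hsub).trans
    ((measure_exists_informationPotential_deviation_le hS hcont hc hs hs2 hH hh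
      (by positivity)).trans_eq ?_)
  rw [two_mul_exp_neg_sq_div_eq hκ hδ0 (by linarith)]

lemma tendsto_measure_lt_of_rate {Ω : ℕ → Type*} [∀ n, MeasurableSpace (Ω n)]
    {μ : (n : ℕ) → Measure (Ω n)} {g : (n : ℕ) → Ω n → ℝ} {C : ℝ}
    (hrate : ∀ n : ℕ, 1 ≤ n → ∀ δ : ℝ, 0 < δ → δ < 1 →
      μ n {z | C * √(Real.log (2 / δ)) * (n : ℝ) ^ (-(1 / 2) : ℝ) < g n z} ≤ ENNReal.ofReal δ)
    {ε : ℝ} (hε : 0 < ε) : Tendsto (fun n => μ n {z | ε < g n z}) atTop (𝓝 0) := by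
  refine ENNReal.tendsto_nhds_zero.2 fun a ha => ?_
  obtain ⟨δ, -, hδ⟩ := ENNReal.lt_iff_exists_real_btwn.1 (lt_min ha one_pos)
  obtain ⟨hδa, hδ1⟩ := lt_min_iff.1 hδ.2
  have hlim : Tendsto (fun n : ℕ => C * √(Real.log (2 / δ)) * (n : ℝ) ^ (-(1 / 2) : ℝ))
      atTop (𝓝 0) := by
    simpa using ((tendsto_rpow_neg_atTop one_half_pos).comp
      tendsto_natCast_atTop_atTop).const_mul (C * √(Real.log (2 / δ)))
  filter_upwards [hlim.eventually_lt_const hε, eventually_ge_atTop 1] with n hnε hn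
  exact (measure_mono fun z (hz : ε < g n z) => hnε.trans hz).trans ((hrate n hn δ
    (ENNReal.ofReal_pos.1 hδ.1) (ENNReal.ofReal_lt_one.1 hδ1)).trans hδa.le)

end Rate

end MEE

end

theorem mainTheorem5_general {X : Type*} [TopologicalSpace X] [MeasurableSpace X]
    [OpensMeasurableSpace X] (ρ : Measure (X × ℝ)) [IsProbabilityMeasure ρ]
    (hsep : ∃ S : Set X, SecondCountableTopology S ∧ ∀ᵐ x ∂ρ.fst, x ∈ S)
    (fstar : X → ℝ) (p : X → ℝ → ℝ) (hmodel : MEE.IsRegressionModel ρ fstar p)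
    (hfourier : ∀ x ξ, (MEE.fourierHat (p x) ξ).im = 0 ∧ 0 ≤ (MEE.fourierHat (p x) ξ).re)
    (hlow : ∃ c₀ C₀ : ℝ, 0 < c₀ ∧ 0 < C₀ ∧
      ∀ x, ∀ ξ ∈ Icc (-c₀) c₀, C₀ ≤ (MEE.fourierHat (p x) ξ).re)
    (H : Set (X → ℝ)) (hcont : ∀ f ∈ H, Continuous f) (hfstar : fstar ∈ H)
    (hbdd : ∃ M : ℝ, ∀ f ∈ H, ∀ x, |fstar x - f x| ≤ M)
    (hentropy : ∃ c s : ℝ, 0 ≤ c ∧ 0 ≤ s ∧ s < 2 ∧ MEE.HasEmpiricalEntropyBound H c s) :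
    (∀ h : ℝ, 0 < h → ∀ b : ℝ,
      MEE.IsInformationErrorMinimizer ρ h (fun x => fstar x + b)) ∧
    ∀ h : ℝ, 0 < h →
      (∀ fz : (n : ℕ) → (Fin n → X × ℝ) → X → ℝ, MEE.IsMEEAlgorithm ρ H h fz →
        ∀ ε : ℝ, 0 < ε →
          Tendsto (fun n : ℕ => (Measure.pi fun _ : Fin n => ρ)
            {z | ε < MEE.adjustedSqError ρ fstar (fz n z)}) atTop (𝓝 0)) ∧
      ∃ C : ℝ, 0 < C ∧
        ∀ fz : (n : ℕ) → (Fin n → X × ℝ) → X → ℝ, MEE.IsMEEAlgorithm ρ H h fz →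
          ∀ n : ℕ, 1 ≤ n → ∀ δ : ℝ, 0 < δ → δ < 1 →
            (Measure.pi fun _ : Fin n => ρ)
              {z | C * Real.sqrt (Real.log (2 / δ)) * (n : ℝ) ^ (-(1 / 2) : ℝ) <
                MEE.adjustedSqError ρ fstar (fz n z)} ≤ ENNReal.ofReal δ := by
  have hreal := fun x ξ => (hfourier x ξ).1
  have hnonneg := fun x ξ => (hfourier x ξ).2
  obtain ⟨S, _, hS⟩ := hsep
  obtain ⟨M, hM⟩ := hbdd
  obtain ⟨c, s, hc, hs, hs2, hH⟩ := hentropy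
  refine ⟨fun h hh b => MEE.isInformationErrorMinimizer_add_const hmodel hreal hnonneg hh b,
    fun h hh => ?_⟩
  obtain ⟨K, hK, hexcess⟩ := MEE.exists_mul_adjustedSqError_le_informationError_sub hmodel
    hreal hnonneg hlow hh M
  obtain ⟨C, hC, hrate⟩ := MEE.exists_rate hS hcont hfstar hc hs hs2 hH hh hK
    fun f hf => hexcess f (hcont f hf).measurable (hM f hf)
  exact ⟨fun fz hfz _ hε => MEE.tendsto_measure_lt_of_rate (hrate fz hfz) hε, C, hC, hrate⟩

theorem mainTheorem5 {X : Type*} [MetricSpace X] [MeasurableSpace X] [BorelSpace X]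
    (ρ : Measure (X × ℝ)) [IsProbabilityMeasure ρ]
    (hsep : ∃ S : Set X, TopologicalSpace.IsSeparable S ∧ ∀ᵐ x ∂ρ.fst, x ∈ S)
    (fstar : X → ℝ) (p : X → ℝ → ℝ)
    (hmodel : MEE.IsRegressionModel ρ fstar p)
    (hadm : MEE.IsAdmissibleModel ρ fstar p)
    (H : Set (X → ℝ)) (hH : MEE.IsAdmissibleSpace ρ fstar H)
    (hP1 : MEE.IsNoiseClassP1 p) :
    (∀ h : ℝ, 0 < h → ∀ b : ℝ,
      MEE.IsInformationErrorMinimizer ρ h (fun x => fstar x + b)) ∧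
    ∀ h : ℝ, 0 < h →
      (∀ fz : (n : ℕ) → (Fin n → X × ℝ) → X → ℝ, MEE.IsMEEAlgorithm ρ H h fz →
        ∀ ε : ℝ, 0 < ε →
          Tendsto (fun n : ℕ => (Measure.pi fun _ : Fin n => ρ)
            {z | ε < MEE.adjustedSqError ρ fstar (fz n z)}) atTop (𝓝 0)) ∧
      ∃ C : ℝ, 0 < C ∧
        ∀ fz : (n : ℕ) → (Fin n → X × ℝ) → X → ℝ, MEE.IsMEEAlgorithm ρ H h fz →
          ∀ n : ℕ, 1 ≤ n → ∀ δ : ℝ, 0 < δ → δ < 1 →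
            (Measure.pi fun _ : Fin n => ρ)
              {z | C * Real.sqrt (Real.log (2 / δ)) * (n : ℝ) ^ (-(1 / 2) : ℝ) <
                MEE.adjustedSqError ρ fstar (fz n z)} ≤ ENNReal.ofReal δ := by
  obtain ⟨M, hM⟩ := hH.bounded
  obtain ⟨c, s, hc, hs, hs2, hentropy⟩ := hH.covering
  exact mainTheorem5_general ρ (hsep.imp fun S hS => ⟨hS.1.secondCountableTopology, hS.2⟩) fstar p
    hmodel hP1.fourier_nonneg hP1.fourier_lower H hH.continuous hH.fstar_mem
    ⟨M + M, fun f hf x => (abs_sub _ _).trans (add_le_add (hM _ hH.fstar_mem x) (hM f hf x))⟩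
    ⟨c, s, hc.le, hs.le, hs2, hentropy⟩
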